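/- For each $K\ge 1$ consider the fully connected $K$-user interference channel $Y_i(t)=\sum_{j=1}^K H_{ij}(t)X_j(t)+Z_i(t)$, $i\in[K]=\{1,\dots,K\}$, $t=1,2,\dots$, with complex inputs and outputs and with noise $Z_i(t)$ that is i.i.d. circularly symmetric complex Gaussian of mean zero and unit variance. At each time $t$ the coefficients $H_{ij}(t)$, $i,j\in[K]$, are drawn independently from one fixed continuous (that is, atomless) probability distribution on $\mathbb C$; their dependence over time is arbitrary (for example constant over time, or independent over time), except that almost surely $\sup_n \frac1n\sum_{t=1}^n\log(1+|H_{ij}(t)|^2)<\infty$ for all $i,j$ (which is automatic if the channel is constant over time). All terminals know the channel realization. For each $i$, the message $W_i$, intended for receiver $i$, is known exactly to the transmitters in a transmit set $\mathcal T_i\subseteq[K]$; the messages are independent and uniformly distributed over their alphabets $\mathcal W_i$. A code of length $n$ and power $P$ consists of encoders that make $(X_j(1),\dots,X_j(n))$ a function of the messages $W_i$ with $j\in\mathcal T_i$, such that $\frac1n\sum_{t=1}^n\mathbb E|X_j(t)|^2\le P$ for every $j$, and of decoders that estimate $W_i$ from $(Y_i(1),\dots,Y_i(n))$. For a given channel realization,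 nonnegative rates $(R_i)_{i\in[K]}$ are achievable at power $P$ if for every $\varepsilon>0$ and all sufficiently large $n$ there is such a code with $\frac1n\log|\mathcal W_i|\ge R_i$ and with probability of error at most $\varepsilon$ for each message $W_i$. A tuple $(d_i)_{i\in[K]}$ of degrees of freedom (DoF) is achievable if for almost every channel realization there are rates $R_i(P)$, achievable at power $P$ for each $P>0$, with $d_i=\lim_{P\to\infty}R_i(P)/\log P$ for each $i$. The DoF region is the closure of the set of achievable tuples, and the DoF number is the supremum of $\sum_i d_i$ over the DoF region. Let $\eta(K,M)$ be the supremum of the DoF number over all choices of the transmit sets with $|\mathcal T_i|\le M$ for all $i\in[K]$, and let $$\tau(M)=\limsup_{K\to\infty}\frac{\eta(K,M)}{K}$$ be the asymptotic per user DoF (equal to $\lim_{K\to\infty}\eta(K,M)/K$ whenever this limit exists). **Theorem.** For every cooperation order $M\ge2$, $$\tau(M)\le\frac{M-1}{M}.$$ -/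

import Mathlib

open MeasureTheory ProbabilityTheory Filter Topology

noncomputable section

namespace CoMP

/-- The circularly symmetric complex Gaussian law of mean zero and unit variance: independent
real and imaginary parts, each of variance `1 / 2`. -/
def stdComplexGaussian : Measure ℂ :=
  ((gaussianReal 0 (1 / 2)).prod (gaussianReal 0 (1 / 2))).map
    (fun p : ℝ × ℝ => (p.1 : ℂ) + (p.2 : ℂ) * Complex.I)

/-- The law of the noise at one receiver over `n` channel uses: independent over time.
The dependence between different receivers plays no role for the error probability of each
message, since a receiver only observes its own output. -/
def noise (n : ℕ) : Measure (Fin n → ℂ) :=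
  Measure.pi (fun _ => stdComplexGaussian)

/-- A block code of length `n` for the `K`-user channel, where `T i` is the set of transmitters
that know message `i` (the transmit set of receiver `i`). The alphabet of message `i` is
`Fin (m i)`. The signal of transmitter `j` is a function of the messages `i` with `j ∈ T i`. -/
structure Code (K n : ℕ) (T : Fin K → Finset (Fin K)) where
  m : Fin K → ℕ
  m_pos : ∀ i, 0 < m i
  enc : (j : Fin K) → ((i : {i : Fin K // j ∈ T i}) → Fin (m i)) → Fin n → ℂ
  dec : (i : Fin K) → (Fin n → ℂ) → Fin (m i)
  dec_measurable : ∀ i, Measurable (dec i)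

namespace Code

variable {K n : ℕ} {T : Fin K → Finset (Fin K)}

/-- A tuple of messages, one for each receiver. -/
abbrev Messages (c : Code K n T) : Type := (i : Fin K) → Fin (c.m i)

/-- Signal of transmitter `j` at time `t` when the messages are `w`. -/
def signal (c : Code K n T) (w : c.Messages) (j : Fin K) (t : Fin n) : ℂ :=
  c.enc j (fun i => w i) t

/-- Expectation over independent, uniformly distributed messages. -/
def avg (c : Code K n T) (f : c.Messages → ℝ) : ℝ :=
  (∑ w : c.Messages, f w) / (Fintype.card c.Messages : ℝ)

/-- The average transmit power of every transmitter is at most `P`: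
`(1 / n) ∑ₜ E |X_j(t)|² ≤ P`. -/
def PowerConstraint (c : Code K n T) (P : ℝ) : Prop :=
  ∀ j, ∑ t : Fin n, c.avg (fun w => ‖c.signal w j t‖ ^ 2) ≤ n * P

/-- Output of receiver `i`: `Y_i(t) = ∑ⱼ H_ij(t) X_j(t) + Z_i(t)`, where `h t i j` is the
coefficient from transmitter `j` to receiver `i` at time `t`. -/
def output (c : Code K n T) (h : ℕ → Matrix (Fin K) (Fin K) ℂ) (w : c.Messages) (i : Fin K)
    (z : Fin n → ℂ) (t : Fin n) : ℂ :=
  ∑ j, h t i j * c.signal w j t + z t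

/-- Probability that receiver `i` decodes its own message wrongly. -/
def errorProb (c : Code K n T) (h : ℕ → Matrix (Fin K) (Fin K) ℂ) (i : Fin K) : ℝ :=
  c.avg (fun w => (noise n).real {z | c.dec i (c.output h w i z) ≠ w i})

end Code

/-- The rate tuple `R` is achievable at power `P` over the channel realization `h`. The codes may
depend on the whole realization (full channel state information). -/
def AchievableRates {K : ℕ} (T : Fin K → Finset (Fin K)) (h : ℕ → Matrix (Fin K) (Fin K) ℂ)
    (P : ℝ) (R : Fin K → ℝ) : Prop :=
  (∀ i, 0 ≤ R i) ∧
  ∀ ε > 0, ∃ N : ℕ, ∀ n ≥ N, ∃ c : Code K n T,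
    c.PowerConstraint P ∧ (∀ i, n * R i ≤ Real.log (c.m i)) ∧ (∀ i, c.errorProb h i ≤ ε)

/-- The tuple `d` of degrees of freedom is achieved over the channel realization `h`:
`d i = lim R i (P) / log P` as `P → ∞`, for some achievable rates `R (P)`. -/
def AchievesDoF {K : ℕ} (T : Fin K → Finset (Fin K)) (h : ℕ → Matrix (Fin K) (Fin K) ℂ)
    (d : Fin K → ℝ) : Prop :=
  ∃ R : ℝ → Fin K → ℝ, (∀ P > 0, AchievableRates T h P (R P)) ∧
    ∀ i, Tendsto (fun P => R P i / Real.log P) atTop (𝓝 (d i))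

variable {Ω : Type*} [MeasurableSpace Ω]

/-- The DoF region of the random channel `H`: the closure of the set of the tuples that are
achieved for almost all channel realizations. -/
def dofRegion {K : ℕ} (Pr : Measure Ω) (H : ℕ → Fin K → Fin K → Ω → ℂ)
    (T : Fin K → Finset (Fin K)) : Set (Fin K → ℝ) :=
  closure {d | ∀ᵐ ω ∂Pr, AchievesDoF T (fun t => Matrix.of fun i j => H t i j ω) d}

/-- The DoF number of the channel with the transmit sets `T`, as an extended real number. -/
def dof {K : ℕ} (Pr : Measure Ω) (H : ℕ → Fin K → Fin K → Ω → ℂ)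
    (T : Fin K → Finset (Fin K)) : EReal :=
  ⨆ d ∈ dofRegion Pr H T, ((∑ i, d i : ℝ) : EReal)

/-- `η(K, M)`: the best DoF number over all choices of transmit sets of size at most `M`. -/
def eta {K : ℕ} (Pr : Measure Ω) (H : ℕ → Fin K → Fin K → Ω → ℂ) (M : ℕ) : EReal :=
  ⨆ (T : Fin K → Finset (Fin K)) (_ : ∀ i, (T i).card ≤ M), dof Pr H T

/-- The asymptotic per user DoF `τ(M)` of a sequence of channels, the `K`-th of which has `K`
users. The upper limit equals the limit of `η(K, M) / K` whenever the latter exists. -/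
def tau (Pr : Measure Ω) (H : (K : ℕ) → ℕ → Fin K → Fin K → Ω → ℂ) (M : ℕ) : EReal :=
  limsup (fun K : ℕ => eta Pr (H K) M / (K : EReal)) atTop

/-- The random coefficients `H t i j` form a fully connected `K`-user channel with coefficient
law `μ`: at each time they are drawn independently from `μ`. The dependence over time is
arbitrary (constant over time, independent over time, ...). The last field says that each link
has finite long-term average of `log (1 + |H_ij(t)|²)`; it is automatic if the channel is
constant over time. -/
structure IsFullyConnected {K : ℕ} (μ : Measure ℂ) (Pr : Measure Ω)
    (H : ℕ → Fin K → Fin K → Ω → ℂ) : Prop where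
  measurable : ∀ t i j, Measurable (H t i j)
  law : ∀ t i j, Pr.map (H t i j) = μ
  indep : ∀ t, iIndepFun (fun p : Fin K × Fin K => H t p.1 p.2) Pr
  bdd : ∀ᵐ ω ∂Pr, ∀ i j, BddAbove (Set.range fun n : ℕ =>
    (∑ t ∈ Finset.range n, Real.log (1 + ‖H t i j ω‖ ^ 2)) / (n : ℝ))

end CoMP

end

/-!
The bound on the DoF number comes from a set `A` of receivers and a set `U` of transmitters of the
same size such that every message intended for a receiver outside `A` is known only to
transmitters in `U`. Whoever sees the outputs of `A` decodes the messages of `A`, hence knows the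
signals of all transmitters outside `U`. After these are subtracted, the `|A|` outputs are noisy
linear equations in the `|U| = |A|` remaining signals, with a square coefficient matrix that is
almost surely invertible. So the outputs outside `A` are known up to noise of bounded power, and
at most `|A|` degrees of freedom are available (`IsFullyConnected.dof_le`).

No entropy is needed to make this precise. The decoding regions of different message tuples are
disjoint, and on the region of the messages `w` the density of the outputs is at most one common
weight `F`: a Gaussian of variance proportional to the received power in the outputs of `A`, times
a Gaussian of bounded variance in the other outputs, centred at their estimate from those in `A`.
The centre depends on the outputs of `A` through the decoder, but it does not influence the inner
integral, so that the integral of `F` is the product of the variances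
(`sum_pi_noise_preimage_le`, `Code.sum_one_sub_error_le`). This integral bounds the number of
messages up to a constant factor. Its logarithm, divided by the block length, is
`|A| log P + O(1)`.

The norm of the inverse matrix varies with time, in an arbitrary manner. At the times at which it
exceeds a bound `L`, the outputs outside `A` get the same variance as those in `A`. Since the
channel matrix has the same law at all times, the expected fraction of such times tends to `0` as
`L → ∞`, and Markov's inequality shows that almost surely it is below any given `δ` for some `L`
and infinitely many block lengths (`ae_frequently_card_filter_le`), which costs at most `K δ`
degrees of freedom. Invertibility holds because the determinant is a nonzero polynomial in
independent atomless coefficients (`pi_zeros_eq_zero`).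

The sets `A` and `U` come from a statement about hypergraphs: among `K` edges of size at most `M`
on `K` vertices there are `b` edges that cover at most `(M - 1) b + 1` vertices, for every `b ≤ K`
(`hasSparseSubfamilies`). With `b = ⌊(K - 1) / M⌋` the complement of these edges gives
`|A| = K - b`, which is `K (M - 1) / M` up to a bounded error.
-/

namespace CoMP

open scoped ENNReal

/-! ### The Gaussian noise and its density -/

/-- Tonelli's theorem for a product of functions of separate coordinates. -/
theorem lintegral_fin_pi_prod {n : ℕ} {E : Type*} [MeasurableSpace E]
    (μ : Fin n → Measure E) [∀ i, SigmaFinite (μ i)] (f : Fin n → E → ℝ≥0∞)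
    (hf : ∀ i, Measurable (f i)) :
    ∫⁻ x, ∏ i, f i (x i) ∂(Measure.pi μ) = ∏ i, ∫⁻ x, f i x ∂(μ i) := by
  induction n with
  | zero => simp
  | succ n ih =>
    have e := (measurePreserving_piFinSuccAbove μ 0).symm
    rw [← e.lintegral_comp_emb (MeasurableEquiv.measurableEmbedding _)]
    have hm : Measurable fun y : Fin n → E => ∏ j : Fin n, f j.succ (y j) :=
      Finset.measurable_fun_prod _ fun j _ => (hf j.succ).comp (measurable_pi_apply j)
    have := lintegral_prod_mul (μ := μ 0) (ν := Measure.pi fun i : Fin n => μ i.succ)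
      (hf 0).aemeasurable hm.aemeasurable
    simp only [MeasurableEquiv.piFinSuccAbove_symm_apply, Fin.insertNthEquiv,
      Fin.prod_univ_succ, Fin.insertNth_zero, Equiv.coe_fn_mk, Fin.cons_succ,
      Fin.zero_succAbove, cast_eq, Fin.cons_zero]
    rw [this, ih _ _ fun i => hf _]

theorem lintegral_pi_prod {ι E : Type*} [Fintype ι] [MeasurableSpace E]
    (μ : ι → Measure E) [∀ i, SigmaFinite (μ i)] (f : ι → E → ℝ≥0∞)
    (hf : ∀ i, Measurable (f i)) :
    ∫⁻ x, ∏ i, f i (x i) ∂(Measure.pi μ) = ∏ i, ∫⁻ x, f i x ∂(μ i) := by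
  let e := (Fintype.equivFin ι).symm
  rw [← (measurePreserving_piCongrLeft _ e).lintegral_comp_emb
    (MeasurableEquiv.measurableEmbedding _)]
  simp_rw [← e.prod_comp, MeasurableEquiv.coe_piCongrLeft, Equiv.piCongrLeft_apply_apply]
  exact lintegral_fin_pi_prod _ _ fun i => hf _

theorem pi_withDensity {ι E : Type*} [Fintype ι] [MeasurableSpace E]
    (μ : ι → Measure E) [∀ i, SigmaFinite (μ i)] (f : ι → E → ℝ≥0∞)
    (hf : ∀ i, Measurable (f i)) [∀ i, SigmaFinite ((μ i).withDensity (f i))] :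
    Measure.pi (fun i => (μ i).withDensity (f i))
      = (Measure.pi μ).withDensity fun x => ∏ i, f i (x i) := by
  refine Measure.pi_eq fun s hs => ?_
  rw [withDensity_apply _ (MeasurableSet.univ_pi hs),
    ← lintegral_indicator (MeasurableSet.univ_pi hs)]
  have : (Set.univ.pi s).indicator (fun x => ∏ i, f i (x i))
      = fun x => ∏ i, (s i).indicator (f i) (x i) := by
    ext x
    by_cases hx : x ∈ Set.univ.pi s
    · rw [Set.indicator_of_mem hx]
      exact Finset.prod_congr rfl fun i _ => (Set.indicator_of_mem (hx i trivial) _).symm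
    · rw [Set.indicator_of_notMem hx]
      simp only [Set.mem_pi, Set.mem_univ, true_imp_iff, not_forall] at hx
      obtain ⟨i, hi⟩ := hx
      exact (Finset.prod_eq_zero (Finset.mem_univ i) (Set.indicator_of_notMem hi _)).symm
  rw [this, lintegral_pi_prod _ _ fun i => (hf i).indicator (hs i)]
  exact Finset.prod_congr rfl fun i _ => by
    rw [lintegral_indicator (hs i), withDensity_apply _ (hs i)]

/-- The density `π⁻¹ exp (-‖z‖² / s)`; for `s = 1` it is that of `stdComplexGaussian`. In general
its total mass is `s`. -/
noncomputable def gaussDensity (s : ℝ) (z : ℂ) : ℝ≥0∞ :=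
  ENNReal.ofReal (Real.pi⁻¹ * Real.exp (-‖z‖ ^ 2 / s))

@[fun_prop]
theorem measurable_gaussDensity (s : ℝ) : Measurable (gaussDensity s) := by
  unfold gaussDensity; fun_prop

theorem lintegral_gaussDensity {s : ℝ} (hs : 0 < s) :
    ∫⁻ z, gaussDensity s z = ENNReal.ofReal s := by
  have h := Complex.integral_exp_neg_mul_rpow (p := 2) (by norm_num) (inv_pos.2 hs)
  have hg : Real.Gamma (2 / 2 + 1) = 1 := by norm_num
  have h2 : (s⁻¹) ^ (-2 / 2 : ℝ) = s := by
    rw [show (-2 / 2 : ℝ) = -1 by norm_num, Real.rpow_neg_one, inv_inv]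
  rw [hg, h2, mul_one] at h
  have he : ∀ z : ℂ, Real.pi⁻¹ * Real.exp (-‖z‖ ^ 2 / s)
      = Real.pi⁻¹ * Real.exp (-s⁻¹ * ‖z‖ ^ (2 : ℝ)) := fun z => by
    congr 2
    rw [Real.rpow_two]; field_simp
  -- A function that is not integrable would have Bochner integral `0`.
  have hint : Integrable fun z : ℂ => Real.exp (-s⁻¹ * ‖z‖ ^ (2 : ℝ)) := by
    by_contra hn
    rw [integral_undef hn] at h
    have : 0 < Real.pi * s := by positivity
    linarith
  unfold gaussDensity
  simp_rw [he]
  rw [← ofReal_integral_eq_lintegral_ofReal (hint.const_mul _)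
    (Eventually.of_forall fun z => by positivity), integral_const_mul, h]
  congr 1
  field_simp

theorem stdComplexGaussian_eq_withDensity :
    stdComplexGaussian = volume.withDensity (gaussDensity 1) := by
  have hv : (1 / 2 : NNReal) ≠ 0 := by norm_num
  have hmeas : Measurable fun p : ℝ × ℝ => (p.1 : ℂ) + (p.2 : ℂ) * Complex.I := by fun_prop
  have hsymm : (fun p : ℝ × ℝ => (p.1 : ℂ) + (p.2 : ℂ) * Complex.I)
      = Complex.measurableEquivRealProd.symm := by
    ext p
    apply Complex.ext <;> simp [Complex.measurableEquivRealProd_symm_apply]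
  have hp : ∀ p : ℝ × ℝ, gaussianPDF 0 (1 / 2) p.1 * gaussianPDF 0 (1 / 2) p.2
      = gaussDensity 1 ((p.1 : ℂ) + (p.2 : ℂ) * Complex.I) := fun p => by
    rw [gaussianPDF, gaussianPDF, ← ENNReal.ofReal_mul (gaussianPDFReal_nonneg _ _ _),
      gaussDensity, gaussianPDFReal_def]
    congr 1
    simp only [sub_zero]
    rw [← Complex.normSq_eq_norm_sq, Complex.normSq_add_mul_I]
    have h2 : (2 * Real.pi * ((1 / 2 : NNReal) : ℝ)) = Real.pi := by
      push_cast; ring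
    rw [h2, mul_mul_mul_comm, ← Real.exp_add, ← mul_inv,
      Real.mul_self_sqrt Real.pi_pos.le]
    congr 2
    push_cast
    ring
  rw [stdComplexGaussian, gaussianReal_of_var_ne_zero _ hv,
    prod_withDensity (measurable_gaussianPDF _ _) (measurable_gaussianPDF _ _)]
  ext s hs
  rw [Measure.map_apply hmeas hs, withDensity_apply _ (hmeas hs), withDensity_apply _ hs,
    ← Measure.volume_eq_prod]
  simp_rw [hp, funext_iff.1 hsymm]
  exact Complex.volume_preserving_equiv_real_prod.symm.setLIntegral_comp_preimage_emb
    (MeasurableEquiv.measurableEmbedding _) _ _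

instance : IsProbabilityMeasure stdComplexGaussian := by
  refine ⟨?_⟩
  rw [stdComplexGaussian_eq_withDensity, withDensity_apply _ MeasurableSet.univ,
    Measure.restrict_univ, lintegral_gaussDensity one_pos, ENNReal.ofReal_one]

instance (n : ℕ) : IsProbabilityMeasure (noise n) := by
  unfold noise; infer_instance

theorem noise_eq_withDensity (n : ℕ) :
    noise n = volume.withDensity fun z : Fin n → ℂ => ∏ t, gaussDensity 1 (z t) := by
  have : SigmaFinite ((volume : Measure ℂ).withDensity (gaussDensity 1)) := by
    rw [← stdComplexGaussian_eq_withDensity]; infer_instance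
  unfold noise
  simp_rw [stdComplexGaussian_eq_withDensity]
  exact pi_withDensity _ _ fun _ => measurable_gaussDensity 1

theorem pi_noise_eq_withDensity (ι : Type*) [Fintype ι] (n : ℕ) :
    Measure.pi (fun _ : ι => noise n)
      = volume.withDensity fun z : ι → Fin n → ℂ => ∏ i, ∏ t, gaussDensity 1 (z i t) := by
  have : SigmaFinite ((volume : Measure (Fin n → ℂ)).withDensity
      fun z => ∏ t, gaussDensity 1 (z t)) := by
    rw [← noise_eq_withDensity]; infer_instance
  simp_rw [noise_eq_withDensity]
  exact pi_withDensity (fun _ : ι => (volume : Measure (Fin n → ℂ)))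
    (fun _ z => ∏ t, gaussDensity 1 (z t)) fun _ => by fun_prop

theorem lintegral_pi_gaussDensity (ι : Type*) [Fintype ι] {n : ℕ} {v : Fin n → ℝ}
    (hv : ∀ t, 0 < v t) :
    ∫⁻ z : ι → Fin n → ℂ, ∏ i, ∏ t, gaussDensity (v t) (z i t)
      = ENNReal.ofReal (∏ t, v t) ^ Fintype.card ι := by
  have h1 : ∫⁻ z : Fin n → ℂ, ∏ t, gaussDensity (v t) (z t) = ENNReal.ofReal (∏ t, v t) := by
    rw [volume_pi, lintegral_pi_prod _ _ fun t => measurable_gaussDensity (v t),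
      ENNReal.ofReal_prod_of_nonneg fun t _ => (hv t).le]
    exact Finset.prod_congr rfl fun t _ => lintegral_gaussDensity (hv t)
  rw [volume_pi, lintegral_pi_prod (fun _ : ι => (volume : Measure (Fin n → ℂ)))
    (fun _ z => ∏ t, gaussDensity (v t) (z t)) fun _ => by fun_prop, h1]
  simp

/-! ### Packing with a Gaussian weight -/

theorem prod_gaussDensity {ι : Type*} [Fintype ι] {n : ℕ} (s : Fin n → ℝ) (z : ι → Fin n → ℂ) :
    ∏ i, ∏ t, gaussDensity (s t) (z i t)
      = ENNReal.ofReal (∏ _i : ι, ∏ _t : Fin n, Real.pi⁻¹)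
        * ENNReal.ofReal (Real.exp (-∑ i, ∑ t, ‖z i t‖ ^ 2 / s t)) := by
  unfold gaussDensity
  have hpos : ∀ (i : ι) (t : Fin n), 0 ≤ Real.pi⁻¹ * Real.exp (-‖z i t‖ ^ 2 / s t) :=
    fun i t => by positivity
  simp_rw [← ENNReal.ofReal_prod_of_nonneg fun t _ => hpos _ t]
  rw [← ENNReal.ofReal_prod_of_nonneg fun i _ => Finset.prod_nonneg fun t _ => hpos i t,
    ← ENNReal.ofReal_mul (by positivity)]
  simp_rw [Finset.prod_mul_distrib, ← Real.exp_sum, neg_div, Finset.sum_neg_distrib]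

/-- An inequality between quadratic exponents is one between the Gaussian weights. The factors
`π⁻¹` in `gaussDensity` do not depend on the scale, so they are the same on both sides. -/
theorem prod_gaussDensity_mul_le {ι κ : Type*} [Fintype ι] [Fintype κ] {n : ℕ}
    {a b : Fin n → ℝ} {C : ℝ} {y z : ι → Fin n → ℂ} {y' z' : κ → Fin n → ℂ}
    (h : ∑ i, ∑ t, ‖y i t‖ ^ 2 / a t + ∑ i, ∑ t, ‖y' i t‖ ^ 2 / b t
      ≤ C + (∑ i, ∑ t, ‖z i t‖ ^ 2 + ∑ i, ∑ t, ‖z' i t‖ ^ 2)) :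
    (∏ i, ∏ t, gaussDensity 1 (z i t)) * ∏ i, ∏ t, gaussDensity 1 (z' i t)
      ≤ ENNReal.ofReal (Real.exp C) * ((∏ i, ∏ t, gaussDensity (a t) (y i t))
        * ∏ i, ∏ t, gaussDensity (b t) (y' i t)) := by
  have h1 := prod_gaussDensity (fun _ => 1) z
  have h2 := prod_gaussDensity (fun _ => 1) z'
  simp only [div_one] at h1 h2
  rw [h1, h2, prod_gaussDensity, prod_gaussDensity]
  have hexp : ENNReal.ofReal (Real.exp (-∑ i, ∑ t, ‖z i t‖ ^ 2))
        * ENNReal.ofReal (Real.exp (-∑ i, ∑ t, ‖z' i t‖ ^ 2))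
      ≤ ENNReal.ofReal (Real.exp C) * (ENNReal.ofReal (Real.exp (-∑ i, ∑ t, ‖y i t‖ ^ 2 / a t))
        * ENNReal.ofReal (Real.exp (-∑ i, ∑ t, ‖y' i t‖ ^ 2 / b t))) := by
    rw [← ENNReal.ofReal_mul (by positivity), ← ENNReal.ofReal_mul (by positivity),
      ← ENNReal.ofReal_mul (by positivity), ← Real.exp_add, ← Real.exp_add, ← Real.exp_add]
    exact ENNReal.ofReal_le_ofReal (Real.exp_le_exp.2 (by linarith))
  calc _ = ENNReal.ofReal (∏ _i : ι, ∏ _t : Fin n, Real.pi⁻¹)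
          * ENNReal.ofReal (∏ _i : κ, ∏ _t : Fin n, Real.pi⁻¹)
          * (ENNReal.ofReal (Real.exp (-∑ i, ∑ t, ‖z i t‖ ^ 2))
            * ENNReal.ofReal (Real.exp (-∑ i, ∑ t, ‖z' i t‖ ^ 2))) := by ring
    _ ≤ _ := mul_le_mul' le_rfl hexp
    _ = _ := by ring

theorem pi_noise_prod_eq_withDensity (ι κ : Type*) [Fintype ι] [Fintype κ] (n : ℕ) :
    (Measure.pi fun _ : ι => noise n).prod (Measure.pi fun _ : κ => noise n)
      = volume.withDensity fun z : (ι → Fin n → ℂ) × (κ → Fin n → ℂ) =>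
        (∏ i, ∏ t, gaussDensity 1 (z.1 i t)) * ∏ i, ∏ t, gaussDensity 1 (z.2 i t) := by
  have : SFinite ((volume : Measure (κ → Fin n → ℂ)).withDensity
      fun z => ∏ i, ∏ t, gaussDensity 1 (z i t)) := by
    rw [← pi_noise_eq_withDensity]; infer_instance
  rw [pi_noise_eq_withDensity, pi_noise_eq_withDensity,
    prod_withDensity (by fun_prop) (by fun_prop), ← Measure.volume_eq_prod]

/-- The integral of a Gaussian weight in two blocks of variables, where the centre of the second
block is an arbitrary measurable function of the first block. -/
theorem lintegral_gaussDensity_shear {ι κ : Type*} [Fintype ι] [Fintype κ] {n : ℕ}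
    {a b : Fin n → ℝ} (ha : ∀ t, 0 < a t) (hb : ∀ t, 0 < b t)
    {r : (ι → Fin n → ℂ) → κ → Fin n → ℂ} (hr : Measurable r) :
    ∫⁻ y : (ι → Fin n → ℂ) × (κ → Fin n → ℂ), (∏ i, ∏ t, gaussDensity (a t) (y.1 i t))
        * ∏ i, ∏ t, gaussDensity (b t) ((y.2 - r y.1) i t)
      = ENNReal.ofReal (∏ t, a t) ^ Fintype.card ι
        * ENNReal.ofReal (∏ t, b t) ^ Fintype.card κ := by
  have hg : Measurable fun z : κ → Fin n → ℂ => ∏ i, ∏ t, gaussDensity (b t) (z i t) := by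
    fun_prop
  have hsub : Measurable fun y : (ι → Fin n → ℂ) × (κ → Fin n → ℂ) => y.2 - r y.1 :=
    measurable_snd.sub (hr.comp measurable_fst)
  have hf : Measurable fun y : (ι → Fin n → ℂ) × (κ → Fin n → ℂ) =>
      ∏ i, ∏ t, gaussDensity (a t) (y.1 i t) := by fun_prop
  have hm : Measurable fun y : (ι → Fin n → ℂ) × (κ → Fin n → ℂ) =>
      (∏ i, ∏ t, gaussDensity (a t) (y.1 i t))
        * ∏ i, ∏ t, gaussDensity (b t) ((y.2 - r y.1) i t) := hf.mul (hg.comp hsub)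
  rw [Measure.volume_eq_prod, lintegral_prod _ hm.aemeasurable]
  have h1 : ∀ y : ι → Fin n → ℂ,
      ∫⁻ y' : κ → Fin n → ℂ, (∏ i, ∏ t, gaussDensity (a t) (y i t))
          * ∏ i, ∏ t, gaussDensity (b t) ((y' - r y) i t)
        = (∏ i, ∏ t, gaussDensity (a t) (y i t))
          * ENNReal.ofReal (∏ t, b t) ^ Fintype.card κ := fun y => by
    rw [lintegral_const_mul' _ _ (by simp [gaussDensity, ENNReal.prod_ne_top]),
      lintegral_sub_right_eq_self (fun z : κ → Fin n → ℂ => ∏ i, ∏ t, gaussDensity (b t) (z i t)),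
      lintegral_pi_gaussDensity _ hb]
  simp only [h1]
  rw [lintegral_mul_const _ (by fun_prop), lintegral_pi_gaussDensity _ ha]

/-- A packing bound. The decoding regions `D w` are disjoint, so if each of the shifted noise
densities is dominated on its region by one common integrable weight, then the integral of the
weight bounds the sum of the probabilities of correct decoding. The weight is Gaussian, its second
block of variables being centred at a function of the first block. -/
theorem sum_pi_noise_preimage_le {ι κ W : Type*} [Fintype ι] [Fintype κ] {n : ℕ}
    (𝒢 : Finset W) (S : W → (ι → Fin n → ℂ) × (κ → Fin n → ℂ))
    (D : W → Set ((ι → Fin n → ℂ) × (κ → Fin n → ℂ)))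
    (hD : ∀ w, MeasurableSet (D w)) (hdisj : Pairwise fun w w' => Disjoint (D w) (D w'))
    {a b : Fin n → ℝ} (ha : ∀ t, 0 < a t) (hb : ∀ t, 0 < b t) (C : ℝ)
    {r : (ι → Fin n → ℂ) → κ → Fin n → ℂ} (hr : Measurable r)
    (hle : ∀ w ∈ 𝒢, ∀ y ∈ D w,
      ∑ i, ∑ t, ‖y.1 i t‖ ^ 2 / a t + ∑ i, ∑ t, ‖(y.2 - r y.1) i t‖ ^ 2 / b t
        ≤ C + (∑ i, ∑ t, ‖(y - S w).1 i t‖ ^ 2 + ∑ i, ∑ t, ‖(y - S w).2 i t‖ ^ 2)) :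
    ∑ w ∈ 𝒢, ((Measure.pi fun _ : ι => noise n).prod (Measure.pi fun _ : κ => noise n))
        ((fun z => z + S w) ⁻¹' D w)
      ≤ ENNReal.ofReal (Real.exp C) * (ENNReal.ofReal (∏ t, a t) ^ Fintype.card ι
        * ENNReal.ofReal (∏ t, b t) ^ Fintype.card κ) := by
  set F : (ι → Fin n → ℂ) × (κ → Fin n → ℂ) → ℝ≥0∞ := fun y =>
    ENNReal.ofReal (Real.exp C) * ((∏ i, ∏ t, gaussDensity (a t) (y.1 i t))
        * ∏ i, ∏ t, gaussDensity (b t) ((y.2 - r y.1) i t)) with hF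
  have hw : ∀ w ∈ 𝒢, ((Measure.pi fun _ : ι => noise n).prod (Measure.pi fun _ : κ => noise n))
        ((fun z => z + S w) ⁻¹' D w) ≤ volume.withDensity F (D w) := fun w hw => by
    have : MeasurableAdd ((ι → Fin n → ℂ) × (κ → Fin n → ℂ)) :=
      ⟨fun c => by fun_prop, fun c => by fun_prop⟩
    have : (volume : Measure ((ι → Fin n → ℂ) × (κ → Fin n → ℂ))).IsAddRightInvariant :=
      Measure.prod.instIsAddRightInvariant
    have hm : MeasurableSet ((fun z => z + S w) ⁻¹' D w) := (measurable_add_const _) (hD w)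
    rw [pi_noise_prod_eq_withDensity, withDensity_apply _ hm, withDensity_apply _ (hD w),
      ← lintegral_indicator hm, ← lintegral_indicator (hD w),
      ← lintegral_sub_right_eq_self _ (S w)]
    refine lintegral_mono fun y => ?_
    by_cases hy : y ∈ D w
    · have hy' : y - S w ∈ (fun z => z + S w) ⁻¹' D w := by simpa using hy
      rw [Set.indicator_of_mem hy', Set.indicator_of_mem hy]
      exact prod_gaussDensity_mul_le (hle w hw y hy)
    · have hy' : y - S w ∉ (fun z => z + S w) ⁻¹' D w := by simpa using hy
      rw [Set.indicator_of_notMem hy']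
      exact zero_le
  calc _ ≤ ∑ w ∈ 𝒢, volume.withDensity F (D w) := Finset.sum_le_sum hw
    _ ≤ volume.withDensity F Set.univ :=
        sum_measure_le_measure_univ (fun w _ => (hD w).nullMeasurableSet)
          fun w _ w' _ hww => (hdisj hww).aedisjoint
    _ = _ := by
        rw [withDensity_apply _ MeasurableSet.univ, Measure.restrict_univ, hF,
          lintegral_const_mul' _ _ ENNReal.ofReal_ne_top, lintegral_gaussDensity_shear ha hb hr]

/-! ### Estimating the outputs outside `A` from those in `A` -/

section

theorem norm_add_sq_le_two_mul (a b : ℂ) : ‖a + b‖ ^ 2 ≤ 2 * (‖a‖ ^ 2 + ‖b‖ ^ 2) :=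
  (pow_le_pow_left₀ (norm_nonneg _) (norm_add_le a b) 2).trans add_sq_le

theorem norm_sum_mul_sq_le {ι : Type*} [Fintype ι] (a b : ι → ℂ) :
    ‖∑ j, a j * b j‖ ^ 2 ≤ (∑ j, ‖a j‖ ^ 2) * ∑ j, ‖b j‖ ^ 2 := by
  refine le_trans ?_ (Finset.sum_mul_sq_le_sq_mul_sq Finset.univ (fun j => ‖a j‖) fun j => ‖b j‖)
  refine pow_le_pow_left₀ (norm_nonneg _) ((norm_sum_le _ _).trans_eq ?_) 2
  simp

theorem sum_mem_add_sum_notMem {ι : Type*} [Fintype ι] [DecidableEq ι] (A : Finset ι)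
    (f : ι → ℝ) : ∑ i : {i // i ∈ A}, f i + ∑ i : {i // i ∉ A}, f i = ∑ i, f i := by
  rw [← Fintype.sum_subtype_add_sum_subtype (· ∈ A) f]
  congr 1
  exact Finset.sum_congr (by ext; simp) fun _ _ => rfl

/-- The squared Frobenius norm of a channel matrix. -/
noncomputable def channelEnergy {K : ℕ} (M : Matrix (Fin K) (Fin K) ℂ) : ℝ := ∑ i, ∑ j, ‖M i j‖ ^ 2

theorem channelEnergy_nonneg {K : ℕ} (M : Matrix (Fin K) (Fin K) ℂ) : 0 ≤ channelEnergy M := by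
  unfold channelEnergy; positivity

/-- The signals of the transmitters in `U`, as received outside `A`, can be recovered from what
the receivers in `A` get, by a linear map `G` of squared Frobenius norm at most `L`. -/
def Resolves {K : ℕ} (A U : Finset (Fin K)) (L : ℝ) (M : Matrix (Fin K) (Fin K) ℂ) : Prop :=
  ∃ G : {i // i ∉ A} → {i // i ∈ A} → ℂ,
    (∀ i : {i // i ∉ A}, ∀ j ∈ U, ∑ k : {i // i ∈ A}, G i k * M k j = M i j)
      ∧ ∑ i, ∑ k, ‖G i k‖ ^ 2 ≤ L

/-- The outputs of the receivers outside `A`, estimated from the outputs `y` of those in `A` and a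
guess `x` of the transmitted signals: the outputs that `x` would give, corrected by `G` applied to
its residual in `A`. -/
noncomputable def estimate {K : ℕ} {A : Finset (Fin K)} (M : Matrix (Fin K) (Fin K) ℂ)
    (G : {i // i ∉ A} → {i // i ∈ A} → ℂ) (x : Fin K → ℂ) (y : {i // i ∈ A} → ℂ)
    (i : {i // i ∉ A}) : ℂ :=
  ∑ j, M i j * x j + ∑ k, G i k * (y k - ∑ j, M k j * x j)

variable {K : ℕ} {A U : Finset (Fin K)} {M : Matrix (Fin K) (Fin K) ℂ}

/-- If the guess of the signals is right outside `U`, then the error of the estimate involves only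
the noise. -/
theorem sub_estimate_eq {G : {i // i ∉ A} → {i // i ∈ A} → ℂ}
    (hG : ∀ i : {i // i ∉ A}, ∀ j ∈ U, ∑ k : {i // i ∈ A}, G i k * M k j = M i j)
    {x x' z : Fin K → ℂ} (hx : ∀ j ∉ U, x' j = x j) (i : {i // i ∉ A}) :
    (∑ j, M i j * x j + z i) - estimate M G x' (fun k => ∑ j, M k j * x j + z k) i
      = z i + ∑ k : {i // i ∈ A}, G i k * -z k := by
  have h1 : ∑ j, M i j * (x j - x' j)
      = ∑ k : {i // i ∈ A}, G i k * ∑ j, M k j * (x j - x' j) := by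
    simp_rw [Finset.mul_sum]
    rw [Finset.sum_comm]
    refine Finset.sum_congr rfl fun j _ => ?_
    by_cases hj : j ∈ U
    · rw [← hG i j hj, Finset.sum_mul]
      exact Finset.sum_congr rfl fun k _ => by ring
    · simp [hx j hj]
  have h2 : ∀ k : {i // i ∈ A}, G i k * (∑ j, M k j * x j + z k - ∑ j, M k j * x' j)
      = G i k * ∑ j, M k j * (x j - x' j) - G i k * -z k := fun k => by
    simp_rw [mul_sub, Finset.sum_sub_distrib]
    ring
  rw [estimate, Finset.sum_congr rfl fun k _ => h2 k, Finset.sum_sub_distrib, ← h1]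
  simp_rw [mul_sub, Finset.sum_sub_distrib]
  ring

theorem sum_norm_sub_estimate_sq_le {G : {i // i ∉ A} → {i // i ∈ A} → ℂ} {L : ℝ}
    (hG : ∀ i : {i // i ∉ A}, ∀ j ∈ U, ∑ k : {i // i ∈ A}, G i k * M k j = M i j)
    (hL : ∑ i, ∑ k, ‖G i k‖ ^ 2 ≤ L)
    {x x' z : Fin K → ℂ} (hx : ∀ j ∉ U, x' j = x j) :
    ∑ i : {i // i ∉ A}, ‖(∑ j, M i j * x j + z i)
        - estimate M G x' (fun k => ∑ j, M k j * x j + z k) i‖ ^ 2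
      ≤ 2 * (1 + L) * ∑ i, ‖z i‖ ^ 2 := by
  have hsplit := sum_mem_add_sum_notMem A fun i => ‖z i‖ ^ 2
  have hA : 0 ≤ ∑ i : {i // i ∈ A}, ‖z i‖ ^ 2 := by positivity
  have hB : 0 ≤ ∑ i : {i // i ∉ A}, ‖z i‖ ^ 2 := by positivity
  have hL0 : 0 ≤ L := le_trans (by positivity) hL
  calc _ ≤ ∑ i : {i // i ∉ A}, 2 * (‖z i‖ ^ 2
          + (∑ k, ‖G i k‖ ^ 2) * ∑ k : {i // i ∈ A}, ‖z k‖ ^ 2) := by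
        refine Finset.sum_le_sum fun i _ => ?_
        rw [sub_estimate_eq hG hx]
        refine (norm_add_sq_le_two_mul _ _).trans ?_
        have := norm_sum_mul_sq_le (G i) fun k : {i // i ∈ A} => -z k
        simp only [norm_neg] at this
        linarith
    _ = 2 * (∑ i : {i // i ∉ A}, ‖z i‖ ^ 2)
          + 2 * (∑ i, ∑ k, ‖G i k‖ ^ 2) * ∑ k : {i // i ∈ A}, ‖z k‖ ^ 2 := by
        rw [← Finset.mul_sum, Finset.sum_add_distrib, ← Finset.sum_mul]
        ring
    _ ≤ 2 * (∑ i : {i // i ∉ A}, ‖z i‖ ^ 2) + 2 * L * ∑ k : {i // i ∈ A}, ‖z k‖ ^ 2 := by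
        gcongr
    _ ≤ _ := by
        rw [← hsplit]
        nlinarith [mul_nonneg hL0 hB]

/-- The outputs at one time, weighted by the inverse of the received power, cost at most half of
the noise energy and half of the relative input energy. -/
theorem sum_norm_output_sq_div_le {P : ℝ} (hP : 0 ≤ P) (x z : Fin K → ℂ) :
    ∑ i, ‖∑ j, M i j * x j + z i‖ ^ 2 / (4 * ((1 + channelEnergy M) * (1 + P)))
      ≤ (∑ j, ‖x j‖ ^ 2) / (2 * (1 + P)) + (∑ i, ‖z i‖ ^ 2) / 2 := by
  have hS := channelEnergy_nonneg M
  have hX : 0 ≤ ∑ j, ‖x j‖ ^ 2 := by positivity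
  have hZ : 0 ≤ ∑ j, ‖z j‖ ^ 2 := by positivity
  have h1 : ∑ i, ‖∑ j, M i j * x j + z i‖ ^ 2
      ≤ 2 * (channelEnergy M * ∑ j, ‖x j‖ ^ 2) + 2 * ∑ i, ‖z i‖ ^ 2 := by
    rw [channelEnergy, Finset.sum_mul, Finset.mul_sum, Finset.mul_sum, ← Finset.sum_add_distrib]
    refine Finset.sum_le_sum fun i _ => (norm_add_sq_le_two_mul _ _).trans ?_
    linarith [norm_sum_mul_sq_le (M i) x]
  rw [← Finset.sum_div, div_add_div _ _ (by positivity) two_ne_zero,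
    div_le_div_iff₀ (by positivity) (by positivity)]
  have h2 : channelEnergy M * ∑ j, ‖x j‖ ^ 2 ≤ (1 + channelEnergy M) * ∑ j, ‖x j‖ ^ 2 := by
    nlinarith
  have h3 : ∑ j, ‖z j‖ ^ 2 ≤ ((1 + channelEnergy M) * (1 + P)) * ∑ j, ‖z j‖ ^ 2 := by
    have : 1 ≤ (1 + channelEnergy M) * (1 + P) := by nlinarith
    nlinarith
  calc _ ≤ (2 * ((1 + channelEnergy M) * ∑ j, ‖x j‖ ^ 2)
        + 2 * (((1 + channelEnergy M) * (1 + P)) * ∑ j, ‖z j‖ ^ 2)) * (2 * (1 + P) * 2) := by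
        gcongr
        linarith
    _ = _ := by ring

/-- The bound on the exponent of the weight at one time at which the channel resolves. -/
theorem weight_exponent_le_of_resolves {P L : ℝ} (hP : 0 ≤ P)
    {G : {i // i ∉ A} → {i // i ∈ A} → ℂ}
    (hG : ∀ i : {i // i ∉ A}, ∀ j ∈ U, ∑ k : {i // i ∈ A}, G i k * M k j = M i j)
    (hL : ∑ i, ∑ k, ‖G i k‖ ^ 2 ≤ L) {x x' : Fin K → ℂ} (hx : ∀ j ∉ U, x' j = x j)
    (z : Fin K → ℂ) :
    ∑ i : {i // i ∈ A}, ‖∑ j, M i j * x j + z i‖ ^ 2 / (4 * ((1 + channelEnergy M) * (1 + P)))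
      + ∑ i : {i // i ∉ A}, ‖(∑ j, M i j * x j + z i)
        - estimate M G x' (fun k => ∑ j, M k j * x j + z k) i‖ ^ 2 / (4 * (1 + L))
      ≤ (∑ j, ‖x j‖ ^ 2) / (2 * (1 + P)) + ∑ i, ‖z i‖ ^ 2 := by
  have hL0 : 0 ≤ L := le_trans (by positivity) hL
  have hS := channelEnergy_nonneg M
  have h1 := sum_norm_output_sq_div_le (M := M) hP x z
  rw [← sum_mem_add_sum_notMem A] at h1
  have h2 : 0 ≤ ∑ i : {i // i ∉ A},
      ‖∑ j, M i j * x j + z i‖ ^ 2 / (4 * ((1 + channelEnergy M) * (1 + P))) := by positivity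
  have h3 : ∑ i : {i // i ∉ A}, ‖(∑ j, M i j * x j + z i)
        - estimate M G x' (fun k => ∑ j, M k j * x j + z k) i‖ ^ 2 / (4 * (1 + L))
      ≤ (∑ i, ‖z i‖ ^ 2) / 2 := by
    rw [← Finset.sum_div, div_le_div_iff₀ (by positivity) two_pos]
    linarith [sum_norm_sub_estimate_sq_le hG hL (z := z) hx]
  linarith

namespace Code

variable {n : ℕ} {T : Fin K → Finset (Fin K)} (c : Code K n T)

/-- The messages decoded by the receivers in `A`; the other messages are set to `0`. -/
def decodeOn (A : Finset (Fin K)) (y : {i // i ∈ A} → Fin n → ℂ) : c.Messages :=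
  fun i => if h : i ∈ A then c.dec i (y ⟨i, h⟩) else ⟨0, c.m_pos i⟩

theorem measurable_decodeOn (A : Finset (Fin K)) : Measurable (c.decodeOn A) := by
  refine measurable_pi_lambda _ fun i => ?_
  unfold decodeOn
  by_cases h : i ∈ A
  · simp only [h, dite_true]
    exact (c.dec_measurable i).comp (measurable_pi_apply _)
  · simp [h]

theorem signal_congr {w w' : c.Messages} {j : Fin K} (h : ∀ i, j ∈ T i → w i = w' i) :
    c.signal w j = c.signal w' j := by
  have : (fun i : {i : Fin K // j ∈ T i} => w i.1)
      = fun i : {i : Fin K // j ∈ T i} => w' i.1 := funext fun i => h i.1 i.2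
  unfold signal
  rw [this]

/-- The outputs of the receivers in `A` and outside `A`, collected into one family. -/
def joinOutputs (y : ({i // i ∈ A} → Fin n → ℂ) × ({i // i ∉ A} → Fin n → ℂ)) (i : Fin K) :
    Fin n → ℂ :=
  if h : i ∈ A then y.1 ⟨i, h⟩ else y.2 ⟨i, h⟩

theorem measurable_joinOutputs (i : Fin K) :
    Measurable fun y : ({i // i ∈ A} → Fin n → ℂ) × ({i // i ∉ A} → Fin n → ℂ) =>
      joinOutputs y i := by
  unfold joinOutputs
  by_cases h : i ∈ A
  · simp only [h, dite_true]; fun_prop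
  · simp only [h, dite_false]; fun_prop

theorem map_joinOutputs (A : Finset (Fin K)) (i : Fin K) :
    ((Measure.pi fun _ : {i // i ∈ A} => noise n).prod
      (Measure.pi fun _ : {i // i ∉ A} => noise n)).map (fun y => joinOutputs y i)
      = noise n := by
  unfold joinOutputs
  by_cases h : i ∈ A
  · simp only [h, dite_true]
    exact ((measurePreserving_eval (fun _ : {i // i ∈ A} => noise n) ⟨i, h⟩).comp
      measurePreserving_fst).map_eq
  · simp only [h, dite_false]
    exact ((measurePreserving_eval (fun _ : {i // i ∉ A} => noise n) ⟨i, h⟩).comp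
      measurePreserving_snd).map_eq

end Code

end

/-! ### The converse for one code -/

/-- The scale of the received power for transmit power `P` over the channel matrix `M`. -/
noncomputable def outputScale {K : ℕ} (P : ℝ) (M : Matrix (Fin K) (Fin K) ℂ) : ℝ :=
  (1 + channelEnergy M) * (1 + P)

open Classical in
/-- The scale of the uncertainty about the outputs outside `A`, given those in `A`: bounded by
`1 + L` if they can be estimated, and by the received power otherwise. -/
noncomputable def residualScale {K : ℕ} (A U : Finset (Fin K)) (L P : ℝ)
    (M : Matrix (Fin K) (Fin K) ℂ) : ℝ :=
  if Resolves A U L M then 1 + L else outputScale P M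

theorem outputScale_pos {K : ℕ} {P : ℝ} (hP : 0 ≤ P) (M : Matrix (Fin K) (Fin K) ℂ) :
    0 < outputScale P M := by
  have := channelEnergy_nonneg M
  unfold outputScale; positivity

theorem residualScale_pos {K : ℕ} (A U : Finset (Fin K)) {L P : ℝ} (hL : 0 ≤ L) (hP : 0 ≤ P)
    (M : Matrix (Fin K) (Fin K) ℂ) : 0 < residualScale A U L P M := by
  unfold residualScale
  split_ifs
  · positivity
  · exact outputScale_pos hP M

namespace Code

variable {K n : ℕ} {T : Fin K → Finset (Fin K)} (c : Code K n T) {A U : Finset (Fin K)}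
  (h : ℕ → Matrix (Fin K) (Fin K) ℂ)

/-- The noiseless outputs when the messages are `w`, split into the receivers in `A` and those
outside `A`. -/
def cleanOutputs (A : Finset (Fin K)) (w : c.Messages) :
    ({i // i ∈ A} → Fin n → ℂ) × ({i // i ∉ A} → Fin n → ℂ) :=
  (fun i t => ∑ j, h t i j * c.signal w j t, fun i t => ∑ j, h t i j * c.signal w j t)

/-- The outputs from which all receivers decode the messages `w`. -/
def decodingRegion (A : Finset (Fin K)) (w : c.Messages) :
    Set (({i // i ∈ A} → Fin n → ℂ) × ({i // i ∉ A} → Fin n → ℂ)) :=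
  {y | ∀ i, c.dec i (joinOutputs y i) = w i}

theorem joinOutputs_add_cleanOutputs (w : c.Messages)
    (z : ({i // i ∈ A} → Fin n → ℂ) × ({i // i ∉ A} → Fin n → ℂ)) (i : Fin K) :
    joinOutputs (z + c.cleanOutputs h A w) i = c.output h w i (joinOutputs z i) := by
  funext t
  by_cases hi : i ∈ A <;> simp [joinOutputs, cleanOutputs, output, hi, add_comm]

theorem measurableSet_decodingRegion (A : Finset (Fin K)) (w : c.Messages) :
    MeasurableSet (c.decodingRegion A w) := by
  have : c.decodingRegion A w = ⋂ i, (fun y => c.dec i (joinOutputs y i)) ⁻¹' {w i} := by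
    ext y; simp [decodingRegion]
  rw [this]
  exact MeasurableSet.iInter fun i =>
    ((c.dec_measurable i).comp (measurable_joinOutputs i)) (measurableSet_singleton _)

theorem measurable_output (w : c.Messages) (i : Fin K) : Measurable (c.output h w i) := by
  unfold output; fun_prop

/-- The union bound: all receivers decode correctly, except with probability at most the sum of
their error probabilities. -/
theorem one_sub_sum_error_le (A : Finset (Fin K)) (w : c.Messages) :
    1 - ∑ i, (noise n).real {z | c.dec i (c.output h w i z) ≠ w i}
      ≤ ((Measure.pi fun _ : {i // i ∈ A} => noise n).prod
          (Measure.pi fun _ : {i // i ∉ A} => noise n)).real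
        ((fun z => z + c.cleanOutputs h A w) ⁻¹' c.decodingRegion A w) := by
  set ν := (Measure.pi fun _ : {i // i ∈ A} => noise n).prod
          (Measure.pi fun _ : {i // i ∉ A} => noise n)
  have hE : (fun z => z + c.cleanOutputs h A w) ⁻¹' c.decodingRegion A w
      = (⋃ i, (fun y => joinOutputs y i) ⁻¹' {z | c.dec i (c.output h w i z) ≠ w i})ᶜ := by
    ext z
    simp [decodingRegion, joinOutputs_add_cleanOutputs]
  have hm : ∀ i, MeasurableSet {z | c.dec i (c.output h w i z) ≠ w i} := fun i =>
    (((c.dec_measurable i).comp (c.measurable_output h w i))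
      (measurableSet_singleton (w i))).compl
  rw [hE, probReal_compl_eq_one_sub
    (MeasurableSet.iUnion fun i => measurable_joinOutputs i (hm i))]
  refine sub_le_sub_left ((measureReal_iUnion_fintype_le _).trans
    (Finset.sum_le_sum fun i _ => ?_)) _
  rw [← map_joinOutputs A i, map_measureReal_apply (measurable_joinOutputs i) (hm i)]

/-- If the messages of the receivers in `A` are decoded correctly, then so are the signals of the
transmitters that know no other message. -/
theorem signal_decodeOn (hU : ∀ i ∉ A, T i ⊆ U) {w : c.Messages}
    {y : ({i // i ∈ A} → Fin n → ℂ) × ({i // i ∉ A} → Fin n → ℂ)}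
    (hy : y ∈ c.decodingRegion A w) {j : Fin K} (hj : j ∉ U) :
    c.signal (c.decodeOn A y.1) j = c.signal w j := by
  refine c.signal_congr fun i hi => ?_
  have hA : i ∈ A := by
    by_contra hA
    exact hj (hU i hA hi)
  have := hy i
  simpa [joinOutputs, decodeOn, hA] using this

/-- The converse for a fixed code: the sum of the probabilities of correct decoding, over a set of
messages of bounded energy, is at most the volume that the outputs occupy in units of the noise. -/
theorem sum_one_sub_error_le (hU : ∀ i ∉ A, T i ⊆ U) {L P : ℝ} (hL : 0 ≤ L) (hP : 0 ≤ P)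
    (𝒢 : Finset c.Messages)
    (h𝒢 : ∀ w ∈ 𝒢, ∑ t : Fin n, ∑ j, ‖c.signal w j t‖ ^ 2 ≤ n * P) :
    ∑ w ∈ 𝒢, (1 - ∑ i, (noise n).real {z | c.dec i (c.output h w i z) ≠ w i})
      ≤ Real.exp (n / 2) * ((∏ t : Fin n, 4 * outputScale P (h t)) ^ A.card
        * (∏ t : Fin n, 4 * residualScale A U L P (h t)) ^ (K - A.card)) := by
  classical
  have ha : ∀ t : Fin n, 0 < 4 * outputScale P (h t) := fun t => by
    have := outputScale_pos hP (h t); positivity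
  have hb : ∀ t : Fin n, 0 < 4 * residualScale A U L P (h t) := fun t => by
    have := residualScale_pos A U hL hP (h t); positivity
  have hG : ∀ t : ℕ, ∃ G : {i // i ∉ A} → {i // i ∈ A} → ℂ, Resolves A U L (h t) →
      (∀ i : {i // i ∉ A}, ∀ j ∈ U, ∑ k : {i // i ∈ A}, G i k * h t k j = h t i j)
        ∧ ∑ i, ∑ k, ‖G i k‖ ^ 2 ≤ L := fun t => by
    by_cases ht : Resolves A U L (h t)
    · obtain ⟨G, hG⟩ := ht
      exact ⟨G, fun _ => hG⟩
    · exact ⟨0, fun h => absurd h ht⟩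
  choose G hG using hG
  -- The centre of the weight: the estimate from the outputs in `A` and the messages decoded from
  -- them, at the times at which the channel resolves.
  set r : ({i // i ∈ A} → Fin n → ℂ) → {i // i ∉ A} → Fin n → ℂ := fun y i t =>
    if Resolves A U L (h t) then
      estimate (h t) (G t) (fun j => c.signal (c.decodeOn A y) j t) (fun k => y k t) i
    else 0 with hr_def
  have hsig : ∀ j t, Measurable fun y => c.signal (c.decodeOn A y) j t := fun j t =>
    (measurable_of_finite fun w => c.signal w j t).comp (c.measurable_decodeOn A)
  have hr : Measurable r := by
    refine measurable_pi_lambda _ fun i => measurable_pi_lambda _ fun t => ?_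
    simp only [hr_def]
    split_ifs
    · unfold estimate
      fun_prop
    · exact measurable_const
  have hdisj : Pairwise fun w w' => Disjoint (c.decodingRegion A w) (c.decodingRegion A w') :=
    fun w w' hww => Set.disjoint_left.2 fun y hy hy' => hww (funext fun i =>
      (hy i).symm.trans (hy' i))
  have key := sum_pi_noise_preimage_le 𝒢 (c.cleanOutputs h A) (c.decodingRegion A)
    (c.measurableSet_decodingRegion A) hdisj ha hb (n / 2) hr ?_
  · have hfin := ENNReal.toReal_mono (by finiteness) key
    rw [ENNReal.toReal_sum fun w _ => measure_ne_top _ _] at hfin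
    refine (Finset.sum_le_sum fun w _ => c.one_sub_sum_error_le h A w).trans (hfin.trans_eq ?_)
    have hc : Fintype.card {i // i ∉ A} = K - A.card := by
      rw [Fintype.card_subtype_compl, Fintype.card_coe, Fintype.card_fin]
    rw [hc, Fintype.card_coe]
    simp only [ENNReal.toReal_mul, ENNReal.toReal_pow]
    rw [ENNReal.toReal_ofReal (Real.exp_pos _).le,
      ENNReal.toReal_ofReal (Finset.prod_nonneg fun t _ => (ha t).le),
      ENNReal.toReal_ofReal (Finset.prod_nonneg fun t _ => (hb t).le)]
  · intro w hw y hy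
    -- The noise that leads from the messages `w` to the outputs `y`.
    set z : Fin n → Fin K → ℂ := fun t i => joinOutputs (y - c.cleanOutputs h A w) i t with hz
    have hy1 : ∀ (i : {i // i ∈ A}) t,
        y.1 i t = ∑ j, h t i j * c.signal w j t + z t i := fun i t => by
      simp [hz, joinOutputs, cleanOutputs, i.2]
    have hy2 : ∀ (i : {i // i ∉ A}) t,
        y.2 i t = ∑ j, h t i j * c.signal w j t + z t i := fun i t => by
      simp [hz, joinOutputs, cleanOutputs, i.2]
    have hz1 : ∀ (i : {i // i ∈ A}) t, (y - c.cleanOutputs h A w).1 i t = z t i := fun i t => by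
      simp [hz, joinOutputs, i.2]
    have hz2 : ∀ (i : {i // i ∉ A}) t, (y - c.cleanOutputs h A w).2 i t = z t i := fun i t => by
      simp [hz, joinOutputs, i.2]
    have hx : ∀ t, ∀ j ∉ U, c.signal (c.decodeOn A y.1) j t = c.signal w j t :=
      fun t j hj => congrFun (c.signal_decodeOn hU hy hj) t
    have htime : ∀ t : Fin n, ∑ i, ‖y.1 i t‖ ^ 2 / (4 * outputScale P (h t))
        + ∑ i, ‖(y.2 - r y.1) i t‖ ^ 2 / (4 * residualScale A U L P (h t))
        ≤ (∑ j, ‖c.signal w j t‖ ^ 2) / (2 * (1 + P)) + ∑ i, ‖z t i‖ ^ 2 := fun t => by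
      simp only [Pi.sub_apply, hr_def, residualScale, outputScale]
      split_ifs with ht
      · simp only [hy1, hy2]
        exact weight_exponent_le_of_resolves hP (hG t ht).1 (hG t ht).2 (hx t) (z t)
      · simp only [sub_zero, hy1, hy2]
        rw [sum_mem_add_sum_notMem A fun i =>
          ‖∑ j, h t i j * c.signal w j t + z t i‖ ^ 2
            / (4 * ((1 + channelEnergy (h t)) * (1 + P)))]
        have hpos : 0 ≤ ∑ i, ‖z t i‖ ^ 2 := by positivity
        linarith [sum_norm_output_sq_div_le (M := h t) hP (fun j => c.signal w j t) (z t)]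
    have hpow : ∑ t : Fin n, (∑ j, ‖c.signal w j t‖ ^ 2) / (2 * (1 + P)) ≤ n / 2 := by
      rw [← Finset.sum_div, div_le_div_iff₀ (by positivity) two_pos]
      have hn : (0 : ℝ) ≤ n := n.cast_nonneg
      nlinarith [h𝒢 w hw]
    simp only [hz1, hz2]
    have hz3 : ∑ i : {i // i ∈ A}, ∑ t, ‖z t i‖ ^ 2 + ∑ i : {i // i ∉ A}, ∑ t, ‖z t i‖ ^ 2
        = ∑ t, ∑ i, ‖z t i‖ ^ 2 := by
      rw [sum_mem_add_sum_notMem A fun i => ∑ t, ‖z t i‖ ^ 2, Finset.sum_comm]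
    rw [hz3]
    calc _ = ∑ t : Fin n, (∑ i, ‖y.1 i t‖ ^ 2 / (4 * outputScale P (h t))
        + ∑ i, ‖(y.2 - r y.1) i t‖ ^ 2 / (4 * residualScale A U L P (h t))) := by
          rw [Finset.sum_add_distrib]
          exact congrArg₂ _ Finset.sum_comm Finset.sum_comm
      _ ≤ ∑ t : Fin n, ((∑ j, ‖c.signal w j t‖ ^ 2) / (2 * (1 + P)) + ∑ i, ‖z t i‖ ^ 2) :=
          Finset.sum_le_sum fun t _ => htime t
      _ ≤ _ := by
          rw [Finset.sum_add_distrib]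
          linarith

end Code

/-! ### From a code to its rates -/

namespace Code

variable {K n : ℕ} {T : Fin K → Finset (Fin K)} (c : Code K n T) {A U : Finset (Fin K)}
  (h : ℕ → Matrix (Fin K) (Fin K) ℂ)

theorem card_messages_pos : (0 : ℝ) < Fintype.card c.Messages := by
  have : Nonempty c.Messages := ⟨fun i => ⟨0, c.m_pos i⟩⟩
  exact_mod_cast Fintype.card_pos

theorem sum_eq_card_mul_avg (f : c.Messages → ℝ) :
    ∑ w, f w = Fintype.card c.Messages * c.avg f := by
  have := c.card_messages_pos
  unfold avg
  field_simp

/-- Markov's inequality for the energy of the codewords: at most a quarter of the messages exceed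
`4 K` times the power. -/
theorem card_filter_energy_le (hn : 0 < n) (hK : 0 < K) {P : ℝ} (hP : 0 < P)
    (hc : c.PowerConstraint P) :
    ((Finset.univ.filter fun w : c.Messages =>
      ¬ ∑ t : Fin n, ∑ j, ‖c.signal w j t‖ ^ 2 ≤ n * (4 * K * P)).card : ℝ)
      ≤ Fintype.card c.Messages / 4 := by
  set s := Finset.univ.filter fun w : c.Messages =>
      ¬ ∑ t : Fin n, ∑ j, ‖c.signal w j t‖ ^ 2 ≤ n * (4 * K * P)
  have hm := c.card_messages_pos
  have hpos : (0 : ℝ) < n * K * P := by positivity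
  have h1 : s.card * (n * (4 * K * P)) ≤ ∑ w, ∑ t : Fin n, ∑ j, ‖c.signal w j t‖ ^ 2 := by
    rw [← nsmul_eq_mul]
    refine (Finset.card_nsmul_le_sum s _ _ fun w hw => ?_).trans
      (Finset.sum_le_univ_sum_of_nonneg fun w => by positivity)
    exact (not_le.1 (Finset.mem_filter.1 hw).2).le
  have h2 : ∑ w, ∑ t : Fin n, ∑ j, ‖c.signal w j t‖ ^ 2
      ≤ Fintype.card c.Messages * (K * (n * P)) := by
    calc _ = ∑ j, ∑ t : Fin n, ∑ w, ‖c.signal w j t‖ ^ 2 := by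
          rw [Finset.sum_congr rfl fun w _ => Finset.sum_comm, Finset.sum_comm]
          exact Finset.sum_congr rfl fun j _ => Finset.sum_comm
      _ = ∑ j, Fintype.card c.Messages
          * ∑ t : Fin n, c.avg (fun w => ‖c.signal w j t‖ ^ 2) := by
          simp_rw [c.sum_eq_card_mul_avg, Finset.mul_sum]
      _ ≤ ∑ _j : Fin K, Fintype.card c.Messages * (n * P) :=
          Finset.sum_le_sum fun j _ => mul_le_mul_of_nonneg_left (hc j) hm.le
      _ = _ := by
          rw [Finset.sum_const, Finset.card_univ, Fintype.card_fin, nsmul_eq_mul]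
          ring
  have h3 : (s.card : ℝ) * 4 * (n * K * P) ≤ Fintype.card c.Messages * (n * K * P) := by
    linarith
  have := le_of_mul_le_mul_right h3 hpos
  linarith

/-- If each receiver errs with probability at most `1 / (4 K)`, then the messages whose codewords
have at most `4 K` times the allowed energy carry half of the total probability of correct decoding.
Errors and codewords of high energy cost a quarter each. -/
theorem half_card_messages_le (hn : 0 < n) (hK : 0 < K) {P : ℝ} (hP : 0 < P)
    (hc : c.PowerConstraint P) (herr : ∀ i, c.errorProb h i ≤ 1 / (4 * K)) :
    (Fintype.card c.Messages : ℝ) / 2 ≤ ∑ w ∈ Finset.univ.filter fun w : c.Messages =>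
        ∑ t : Fin n, ∑ j, ‖c.signal w j t‖ ^ 2 ≤ n * (4 * K * P),
      (1 - ∑ i, (noise n).real {z | c.dec i (c.output h w i z) ≠ w i}) := by
  have hm := c.card_messages_pos
  have h1 : (Fintype.card c.Messages : ℝ) * (3 / 4)
      ≤ ∑ w, (1 - ∑ i, (noise n).real {z | c.dec i (c.output h w i z) ≠ w i}) := by
    rw [Finset.sum_sub_distrib, Finset.sum_comm]
    have : ∀ i, ∑ w : c.Messages, (noise n).real {z | c.dec i (c.output h w i z) ≠ w i}
        ≤ Fintype.card c.Messages * (1 / (4 * K)) := fun i => by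
      rw [c.sum_eq_card_mul_avg]
      exact mul_le_mul_of_nonneg_left (herr i) hm.le
    have h2 := Finset.sum_le_sum fun i (_ : i ∈ (Finset.univ : Finset (Fin K))) => this i
    have hK' : (0 : ℝ) < K := by exact_mod_cast hK
    have h3 : (K : ℝ) * (Fintype.card c.Messages * (1 / (4 * K)))
        = Fintype.card c.Messages / 4 := by field_simp
    simp only [Finset.sum_const, Finset.card_univ, Fintype.card_fin, nsmul_eq_mul, h3] at h2 ⊢
    linarith
  rw [← Finset.sum_filter_add_sum_filter_not Finset.univ fun w : c.Messages =>
        ∑ t : Fin n, ∑ j, ‖c.signal w j t‖ ^ 2 ≤ n * (4 * K * P)] at h1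
  have h4 : ∑ w ∈ Finset.univ.filter fun w : c.Messages =>
        ¬ ∑ t : Fin n, ∑ j, ‖c.signal w j t‖ ^ 2 ≤ n * (4 * K * P),
      (1 - ∑ i, (noise n).real {z | c.dec i (c.output h w i z) ≠ w i})
        ≤ Fintype.card c.Messages / 4 := by
    refine le_trans ?_ (c.card_filter_energy_le hn hK hP hc)
    rw [Finset.cast_card]
    refine Finset.sum_le_sum fun w _ => ?_
    have : 0 ≤ ∑ i, (noise n).real {z | c.dec i (c.output h w i z) ≠ w i} := by positivity
    linarith
  linarith

/-- The sum rate of a good code is bounded by the logarithms of the scales of the outputs: those of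
the received power for the receivers in `A`, and those of the residual uncertainty for the
others. -/
theorem sum_log_card_le (hU : ∀ i ∉ A, T i ⊆ U) (hn : 0 < n) (hK : 0 < K) {L P : ℝ} (hL : 0 ≤ L)
    (hP : 0 < P) (hc : c.PowerConstraint P) (herr : ∀ i, c.errorProb h i ≤ 1 / (4 * K)) :
    ∑ i, Real.log (c.m i) ≤ Real.log 2 + n / 2
      + A.card * ∑ t ∈ Finset.range n, Real.log (4 * outputScale (4 * K * P) (h t))
      + (K - A.card : ℕ)
        * ∑ t ∈ Finset.range n, Real.log (4 * residualScale A U L (4 * K * P) (h t)) := by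
  have hP' : 0 ≤ 4 * K * P := by positivity
  have ha : ∀ t, 0 < 4 * outputScale (4 * K * P) (h t) := fun t => by
    have := outputScale_pos hP' (h t); positivity
  have hb : ∀ t, 0 < 4 * residualScale A U L (4 * K * P) (h t) := fun t => by
    have := residualScale_pos A U hL hP' (h t); positivity
  have h1 := (c.half_card_messages_le h hn hK hP hc herr).trans
    (c.sum_one_sub_error_le h hU hL hP' _ fun w hw => (Finset.mem_filter.1 hw).2)
  have hcard : (Fintype.card c.Messages : ℝ) = ∏ i, (c.m i : ℝ) := by
    simp [Messages]
  have hlog := Real.log_le_log (by have := c.card_messages_pos; positivity) h1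
  have hm : ∀ i, (c.m i : ℝ) ≠ 0 := fun i => by exact_mod_cast (c.m_pos i).ne'
  have hpa : 0 < ∏ t : Fin n, 4 * outputScale (4 * K * P) (h t) :=
    Finset.prod_pos fun t _ => ha t
  have hpb : 0 < ∏ t : Fin n, 4 * residualScale A U L (4 * K * P) (h t) :=
    Finset.prod_pos fun t _ => hb t
  have hla : Real.log (∏ t : Fin n, 4 * outputScale (4 * K * P) (h t))
      = ∑ t ∈ Finset.range n, Real.log (4 * outputScale (4 * K * P) (h t)) := by
    rw [Real.log_prod fun t _ => (ha _).ne',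
      Fin.sum_univ_eq_sum_range fun t => Real.log (4 * outputScale (4 * K * P) (h t))]
  have hlb : Real.log (∏ t : Fin n, 4 * residualScale A U L (4 * K * P) (h t))
      = ∑ t ∈ Finset.range n, Real.log (4 * residualScale A U L (4 * K * P) (h t)) := by
    rw [Real.log_prod fun t _ => (hb _).ne',
      Fin.sum_univ_eq_sum_range fun t => Real.log (4 * residualScale A U L (4 * K * P) (h t))]
  rw [Real.log_div c.card_messages_pos.ne' two_ne_zero, hcard, Real.log_prod fun i _ => hm i,
    Real.log_mul (Real.exp_pos _).ne' (by positivity), Real.log_exp,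
    Real.log_mul (by positivity) (by positivity), Real.log_pow, Real.log_pow,
    hla, hlb] at hlog
  linarith

end Code

theorem one_add_sum_le_prod_one_add {ι : Type*} (s : Finset ι) {f : ι → ℝ}
    (hf : ∀ i, 0 ≤ f i) : 1 + ∑ i ∈ s, f i ≤ ∏ i ∈ s, (1 + f i) := by
  classical
  induction s using Finset.induction_on with
  | empty => simp
  | insert i s hi ih =>
    rw [Finset.sum_insert hi, Finset.prod_insert hi]
    have := Finset.sum_nonneg fun j (_ : j ∈ s) => hf j
    nlinarith [hf i]

theorem log_one_add_channelEnergy_le {K : ℕ} (M : Matrix (Fin K) (Fin K) ℂ) :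
    Real.log (1 + channelEnergy M) ≤ ∑ i, ∑ j, Real.log (1 + ‖M i j‖ ^ 2) := by
  have hpos : ∀ i j, (0 : ℝ) < 1 + ‖M i j‖ ^ 2 := fun i j => by positivity
  have := channelEnergy_nonneg M
  rw [← Fintype.sum_prod_type', ← Real.log_prod fun p _ => (hpos p.1 p.2).ne', channelEnergy,
    ← Fintype.sum_prod_type' (f := fun i j => ‖M i j‖ ^ 2)]
  refine Real.log_le_log (by positivity) ?_
  exact one_add_sum_le_prod_one_add _ fun p => by positivity

theorem log_four_mul_outputScale_le {K : ℕ} {P : ℝ} (hP : 0 ≤ P)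
    (M : Matrix (Fin K) (Fin K) ℂ) :
    Real.log (4 * outputScale P M)
      ≤ Real.log 4 + ∑ i, ∑ j, Real.log (1 + ‖M i j‖ ^ 2) + Real.log (1 + P) := by
  have := channelEnergy_nonneg M
  rw [outputScale, Real.log_mul (by norm_num) (by positivity),
    Real.log_mul (by positivity) (by positivity)]
  linarith [log_one_add_channelEnergy_le M]

open Classical in
theorem log_four_mul_residualScale_le {K : ℕ} (A U : Finset (Fin K)) {L P : ℝ} (hL : 0 ≤ L)
    (hP : 0 ≤ P) (M : Matrix (Fin K) (Fin K) ℂ) :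
    Real.log (4 * residualScale A U L P M)
      ≤ Real.log 4 + Real.log (1 + L) + ∑ i, ∑ j, Real.log (1 + ‖M i j‖ ^ 2)
        + if Resolves A U L M then 0 else Real.log (1 + P) := by
  have h1 : 0 ≤ ∑ i, ∑ j, Real.log (1 + ‖M i j‖ ^ 2) :=
    Finset.sum_nonneg fun i _ => Finset.sum_nonneg fun j _ =>
      Real.log_nonneg (by linarith [sq_nonneg ‖M i j‖])
  have h2 : 0 ≤ Real.log (1 + L) := Real.log_nonneg (by linarith)
  unfold residualScale
  split_ifs
  · rw [Real.log_mul (by norm_num) (by positivity)]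
    linarith
  · linarith [log_four_mul_outputScale_le hP M]

/-! ### The degrees of freedom over a fixed channel realization -/

section

variable {K : ℕ} {T : Fin K → Finset (Fin K)} {A U : Finset (Fin K)}
  {h : ℕ → Matrix (Fin K) (Fin K) ℂ}

open Classical in
/-- If the channel fails to resolve at a fraction of at most `δ` of the time, along arbitrarily
large block lengths, then the sum rate at power `P` is at most `|A| + K δ` times `log P`, up to a
constant that does not depend on `P`. -/
theorem sum_rate_le (hU : ∀ i ∉ A, T i ⊆ U) (hK : 0 < K) {C δ L P : ℝ} (hC0 : 0 ≤ C)
    (hC : ∀ n : ℕ, ∑ t ∈ Finset.range n, ∑ i, ∑ j, Real.log (1 + ‖h t i j‖ ^ 2) ≤ n * C)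
    (hL : 0 ≤ L)
    (hfreq : ∃ᶠ n : ℕ in atTop,
      (((Finset.range n).filter fun t => ¬ Resolves A U L (h t)).card : ℝ) ≤ δ * n)
    (hP : 0 < P) {R : Fin K → ℝ} (hR : AchievableRates T h P R) :
    ∑ i, R i ≤ Real.log 2 + 1 / 2 + K * (Real.log 4 + C) + K * (Real.log 4 + Real.log (1 + L) + C)
      + (A.card + K * δ) * Real.log (1 + 4 * K * P) := by
  have hK' : (0 : ℝ) < K := by exact_mod_cast hK
  obtain ⟨N, hN⟩ := hR.2 (1 / (4 * K)) (by positivity)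
  obtain ⟨n, hbad, hn⟩ := (hfreq.and_eventually (eventually_ge_atTop (max N 1))).exists
  obtain ⟨c, hpow, hrate, herr⟩ := hN n (le_of_max_le_left hn)
  have hn0 : 0 < n := le_of_max_le_right hn
  have hn1 : (1 : ℝ) ≤ n := by exact_mod_cast hn0
  have hP' : 0 ≤ 4 * K * P := by positivity
  have hlog := c.sum_log_card_le h hU hn0 hK hL hP hpow herr
  have hl : 0 ≤ Real.log (1 + 4 * K * P) := Real.log_nonneg (by linarith)
  have hl4 : 0 ≤ Real.log 4 := Real.log_nonneg (by norm_num)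
  have hlL : 0 ≤ Real.log (1 + L) := Real.log_nonneg (by linarith)
  have hl2 : 0 ≤ Real.log 2 := Real.log_nonneg (by norm_num)
  set ℓ := Real.log (1 + 4 * K * P)
  have hsum1 : ∑ t ∈ Finset.range n, Real.log (4 * outputScale (4 * K * P) (h t))
      ≤ n * (Real.log 4 + C + ℓ) := by
    refine (Finset.sum_le_sum fun t _ => log_four_mul_outputScale_le hP' (h t)).trans ?_
    rw [Finset.sum_add_distrib, Finset.sum_add_distrib]
    simp only [Finset.sum_const, Finset.card_range, nsmul_eq_mul]
    linarith [hC n]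
  have hsum2 : ∑ t ∈ Finset.range n, Real.log (4 * residualScale A U L (4 * K * P) (h t))
      ≤ n * (Real.log 4 + Real.log (1 + L) + C) + δ * n * ℓ := by
    refine (Finset.sum_le_sum fun t _ => log_four_mul_residualScale_le A U hL hP' (h t)).trans ?_
    rw [Finset.sum_add_distrib, Finset.sum_add_distrib]
    simp only [Finset.sum_const, Finset.card_range, nsmul_eq_mul]
    have : ∑ t ∈ Finset.range n, (if Resolves A U L (h t) then 0 else ℓ) ≤ δ * n * ℓ := by
      simp_rw [← ite_not (p := Resolves A U L _)]
      rw [← Finset.sum_filter, Finset.sum_const, nsmul_eq_mul]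
      exact mul_le_mul_of_nonneg_right hbad hl
    linarith [hC n]
  have hδ : 0 ≤ δ * n := le_trans (Nat.cast_nonneg _) hbad
  have hAK : (A.card : ℝ) ≤ K := by
    exact_mod_cast (Finset.card_le_univ A).trans_eq (Fintype.card_fin K)
  have hBK : ((K - A.card : ℕ) : ℝ) ≤ K := by exact_mod_cast Nat.sub_le _ _
  have hmul1 := mul_le_mul_of_nonneg_left hsum1 (Nat.cast_nonneg A.card)
  have hmul2 := mul_le_mul_of_nonneg_left hsum2 (Nat.cast_nonneg (K - A.card))
  have hmul3 : (A.card : ℝ) * (n * (Real.log 4 + C)) ≤ K * (n * (Real.log 4 + C)) :=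
    mul_le_mul_of_nonneg_right hAK (by positivity)
  have hmul4 := mul_le_mul_of_nonneg_right hBK
    (show 0 ≤ n * (Real.log 4 + Real.log (1 + L) + C) + δ * n * ℓ by positivity)
  have hR' : n * ∑ i, R i ≤ ∑ i, Real.log (c.m i) := by
    rw [Finset.mul_sum]
    exact Finset.sum_le_sum fun i _ => hrate i
  have hl2n : Real.log 2 ≤ n * Real.log 2 := le_mul_of_one_le_left hl2 hn1
  refine le_of_mul_le_mul_left ?_ (lt_of_lt_of_le one_pos hn1)
  calc n * ∑ i, R i ≤ _ := hR'
    _ ≤ _ := hlog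
    _ ≤ n * Real.log 2 + n / 2 + (K * (n * (Real.log 4 + C)) + A.card * (n * ℓ))
        + K * (n * (Real.log 4 + Real.log (1 + L) + C) + δ * n * ℓ) := by linarith
    _ = _ := by ring

open Classical in
/-- The converse over one channel realization: if the channel resolves at almost all times, in the
sense of arbitrarily small fractions along arbitrarily large block lengths, then at most `|A|`
degrees of freedom are achieved. -/
theorem sum_dof_le (hU : ∀ i ∉ A, T i ⊆ U)
    (hbdd : ∀ i j, BddAbove (Set.range fun n : ℕ =>
      (∑ t ∈ Finset.range n, Real.log (1 + ‖h t i j‖ ^ 2)) / (n : ℝ)))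
    (hres : ∀ δ : ℝ, 0 < δ → ∃ L : ℝ, 0 ≤ L ∧ ∃ᶠ n : ℕ in atTop,
      (((Finset.range n).filter fun t => ¬ Resolves A U L (h t)).card : ℝ) ≤ δ * n)
    {d : Fin K → ℝ} (hd : AchievesDoF T h d) : ∑ i, d i ≤ A.card := by
  rcases Nat.eq_zero_or_pos K with rfl | hK
  · simp
  have hK' : (0 : ℝ) < K := by exact_mod_cast hK
  choose B hB using hbdd
  have hB' : ∀ i j (n : ℕ), ∑ t ∈ Finset.range n, Real.log (1 + ‖h t i j‖ ^ 2)
      ≤ n * |B i j| := fun i j n => by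
    rcases Nat.eq_zero_or_pos n with rfl | hn
    · simp
    · have h1 := (hB i j ⟨n, rfl⟩).trans (le_abs_self _)
      rwa [div_le_iff₀' (by exact_mod_cast hn)] at h1
  have hC : ∀ n : ℕ, ∑ t ∈ Finset.range n, ∑ i, ∑ j, Real.log (1 + ‖h t i j‖ ^ 2)
      ≤ n * ∑ i, ∑ j, |B i j| := fun n => by
    rw [Finset.sum_comm, Finset.mul_sum]
    refine Finset.sum_le_sum fun i _ => ?_
    rw [Finset.sum_comm, Finset.mul_sum]
    exact Finset.sum_le_sum fun j _ => hB' i j n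
  obtain ⟨R, hR, hlim⟩ := hd
  have hmain : ∀ δ : ℝ, 0 < δ → ∑ i, d i ≤ A.card + K * δ := fun δ hδ => by
    obtain ⟨L, hL, hfreq⟩ := hres δ hδ
    obtain ⟨C', hC'⟩ : ∃ C', ∀ P > 0, ∑ i, R P i ≤ C'
        + (A.card + K * δ) * Real.log (1 + 4 * K * P) :=
      ⟨_, fun P hP => sum_rate_le hU hK (by positivity) hC hL hfreq hP (hR P hP)⟩
    have hl1 : Tendsto (fun P => ∑ i, R P i / Real.log P) atTop (𝓝 (∑ i, d i)) :=
      tendsto_finsetSum _ fun i _ => hlim i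
    have hl2 : Tendsto (fun P => (C' + (A.card + K * δ) * Real.log (1 + 4 * K)) / Real.log P
        + (A.card + K * δ)) atTop (𝓝 (0 + (A.card + K * δ))) :=
      (tendsto_const_nhds.div_atTop Real.tendsto_log_atTop).add_const _
    rw [zero_add] at hl2
    refine le_of_tendsto_of_tendsto hl1 hl2 ?_
    filter_upwards [eventually_gt_atTop 1] with P hP
    have hlP : 0 < Real.log P := Real.log_pos hP
    have hlog : Real.log (1 + 4 * K * P) ≤ Real.log (1 + 4 * K) + Real.log P := by
      rw [← Real.log_mul (by positivity) (by positivity)]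
      exact Real.log_le_log (by positivity) (by nlinarith)
    have h1 := hC' P (by linarith)
    have h2 := mul_le_mul_of_nonneg_left hlog (show 0 ≤ A.card + K * δ by positivity)
    rw [← Finset.sum_div, div_add' _ _ _ hlP.ne']
    exact div_le_div_of_nonneg_right (by linarith) hlP.le
  refine le_of_forall_pos_le_add fun ε hε => ?_
  have := hmain (ε / K) (by positivity)
  rwa [mul_div_cancel₀ _ hK'.ne'] at this

end

/-! ### Zeros of polynomials and the frequency of rare events -/

/-- The case of the variables `0, …, n - 1` of `pi_zeros_eq_zero`, by induction on `n`. -/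
theorem pi_fin_zeros_eq_zero (μ : Measure ℂ) [SigmaFinite μ] [NullSingletonClass μ] {n : ℕ}
    {p : MvPolynomial (Fin n) ℂ} (hp : p ≠ 0) :
    Measure.pi (fun _ : Fin n => μ) {x | MvPolynomial.eval x p = 0} = 0 := by
  induction n with
  | zero =>
    have : {x : Fin 0 → ℂ | MvPolynomial.eval x p = 0} = ∅ := by
      refine Set.eq_empty_of_forall_notMem fun x hx => hp ?_
      obtain ⟨a, rfl⟩ := MvPolynomial.C_surjective (Fin 0) p
      have : a = 0 := by simpa using hx
      simp [this]
    simp [this]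
  | succ n ih =>
    have hS : MeasurableSet {x : Fin (n + 1) → ℂ | MvPolynomial.eval x p = 0} :=
      (MvPolynomial.continuous_eval p).measurable (measurableSet_singleton 0)
    have e := (measurePreserving_piFinSuccAbove (fun _ : Fin (n + 1) => μ) 0).symm
    rw [← e.measure_preimage hS.nullMeasurableSet,
      Measure.measure_prod_null (e.measurable hS)]
    -- As a polynomial in the first variable, `p` has finitely many roots among the constants;
    -- at any other value of that variable a nonzero polynomial in the other variables remains.
    set f := MvPolynomial.finSuccEquiv ℂ n p with hf
    have hf0 : f ≠ 0 := by simpa [hf] using hp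
    have hfin : {x : ℂ | f.eval (MvPolynomial.C x) = 0}.Finite :=
      (Polynomial.finite_setOfPred_isRoot hf0).preimage
        (MvPolynomial.C_injective (Fin n) ℂ).injOn
    filter_upwards [measure_eq_zero_iff_ae_notMem.1 (hfin.measure_zero μ)] with x hx
    refine measure_mono_null (fun y hy => ?_) (ih hx)
    have h1 : MvPolynomial.eval (Fin.cons x y) p = 0 := by
      simpa [MeasurableEquiv.piFinSuccAbove_symm_apply, Fin.insertNthEquiv] using hy
    rw [MvPolynomial.eval_eq_eval_mv_eval'] at h1
    have h2 := Polynomial.eval₂_at_apply (p := f) (MvPolynomial.eval y) (MvPolynomial.C x)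
    rw [MvPolynomial.eval_C, ← Polynomial.eval_map, h1] at h2
    exact h2.symm

/-- The zeros of a nonzero polynomial in several variables form a null set for every power of an
atomless measure: with all but one variable in the coefficients, only finitely many values of that
variable make the polynomial vanish identically. -/
theorem pi_zeros_eq_zero (μ : Measure ℂ) [SigmaFinite μ] [NullSingletonClass μ] {σ : Type*}
    [Fintype σ] {p : MvPolynomial σ ℂ} (hp : p ≠ 0) :
    Measure.pi (fun _ : σ => μ) {x | MvPolynomial.eval x p = 0} = 0 := by
  let e := (Fintype.equivFin σ).symm
  have hS : MeasurableSet {x : σ → ℂ | MvPolynomial.eval x p = 0} :=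
    (MvPolynomial.continuous_eval p).measurable (measurableSet_singleton 0)
  rw [← (measurePreserving_piCongrLeft (fun _ : σ => μ) e).measure_preimage hS.nullMeasurableSet]
  have hp' : MvPolynomial.rename e.symm p ≠ 0 := fun h =>
    hp (MvPolynomial.rename_injective _ e.symm.injective (by simpa using h))
  refine measure_mono_null (fun y hy => ?_) (pi_fin_zeros_eq_zero μ hp')
  have h1 : (MeasurableEquiv.piCongrLeft (fun _ : σ => ℂ) e) y = y ∘ e.symm := by
    funext i
    obtain ⟨j, rfl⟩ := e.surjective i
    simp [MeasurableEquiv.coe_piCongrLeft, Equiv.piCongrLeft_apply_apply]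
  have h2 : MvPolynomial.eval (y ∘ e.symm) p = 0 := by simpa [h1] using hy
  simpa [MvPolynomial.eval_rename] using h2

/-- For identically distributed observations, with an arbitrary dependence between them, and rare
events `B m`: almost surely, for every `δ` there is an `m` such that along arbitrarily large `n`
the fraction of the first `n` observations that lie in `B m` is at most `δ`. -/
theorem ae_frequently_card_filter_le {Ω E : Type*} [MeasurableSpace Ω] [MeasurableSpace E]
    (Pr : Measure Ω) [IsProbabilityMeasure Pr] {X : ℕ → Ω → E} (hX : ∀ t, Measurable (X t))
    {Λ : Measure E} (hlaw : ∀ t, Pr.map (X t) = Λ) {B : ℕ → Set E}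
    (hB : ∀ m, MeasurableSet (B m)) (hlim : Tendsto (fun m => Λ (B m)) atTop (𝓝 0))
    [∀ m x, Decidable (x ∈ B m)] :
    ∀ᵐ ω ∂Pr, ∀ δ : ℝ, 0 < δ → ∃ m, ∃ᶠ n : ℕ in atTop,
      (((Finset.range n).filter fun t => X t ω ∈ B m).card : ℝ) ≤ δ * n := by
  have hmarkov : ∀ δ : ℝ, 0 < δ → ∀ m n : ℕ, 0 < n →
      Pr {ω | δ * n < (((Finset.range n).filter fun t => X t ω ∈ B m).card : ℝ)}
        ≤ Λ (B m) / ENNReal.ofReal δ := fun δ hδ m n hn => by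
    have hmeas : ∀ t, Measurable fun ω => (X t ⁻¹' B m).indicator (1 : Ω → ℝ≥0∞) ω := fun t =>
      measurable_one.indicator (hX t (hB m))
    have hint : ∫⁻ ω, ∑ t ∈ Finset.range n, (X t ⁻¹' B m).indicator (1 : Ω → ℝ≥0∞) ω ∂Pr
        = n * Λ (B m) := by
      rw [lintegral_finsetSum _ fun t _ => hmeas t]
      have : ∀ t, ∫⁻ ω, (X t ⁻¹' B m).indicator (1 : Ω → ℝ≥0∞) ω ∂Pr = Λ (B m) := fun t => by
        rw [lintegral_indicator_one (hX t (hB m)), ← hlaw t, Measure.map_apply (hX t) (hB m)]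
      simp [this]
    have h1 := meas_ge_le_lintegral_div (μ := Pr)
      (f := fun ω => ∑ t ∈ Finset.range n, (X t ⁻¹' B m).indicator (1 : Ω → ℝ≥0∞) ω)
      (Finset.measurable_fun_sum _ fun t _ => hmeas t).aemeasurable
      (ε := ENNReal.ofReal δ * n) (by positivity) (by finiteness)
    rw [hint, mul_comm (ENNReal.ofReal δ), ENNReal.mul_div_mul_left _ _ (by positivity)
      (by finiteness)] at h1
    refine (measure_mono fun ω hω => ?_).trans h1
    have h2 : ∑ t ∈ Finset.range n, (X t ⁻¹' B m).indicator (1 : Ω → ℝ≥0∞) ω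
        = (((Finset.range n).filter fun t => X t ω ∈ B m).card : ℝ≥0∞) := by
      have : ∀ t, (X t ⁻¹' B m).indicator (1 : Ω → ℝ≥0∞) ω
          = if X t ω ∈ B m then 1 else 0 := fun t => by
        by_cases h : X t ω ∈ B m <;> simp [h]
      simp [this]
    simp only [Set.mem_ofPred_eq] at hω ⊢
    rw [h2, ← ENNReal.ofReal_natCast n, ← ENNReal.ofReal_mul (Nat.cast_nonneg _),
      ← ENNReal.ofReal_natCast (Finset.card _)]
    exact ENNReal.ofReal_le_ofReal (by linarith)
  have hδ : ∀ δ : ℝ, 0 < δ → ∀ᵐ ω ∂Pr, ∃ m, ∃ᶠ n : ℕ in atTop,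
      (((Finset.range n).filter fun t => X t ω ∈ B m).card : ℝ) ≤ δ * n := fun δ hδ => by
    rw [ae_iff]
    simp only [not_exists, not_frequently, not_le]
    refine le_antisymm (ge_of_tendsto' (x := atTop)
      (f := fun m => Λ (B m) / ENNReal.ofReal δ) ?_ fun m => ?_) zero_le
    · have := ENNReal.Tendsto.div_const hlim (b := ENNReal.ofReal δ) (Or.inr (by positivity))
      simpa using this
    · have hsub : {ω | ∀ m, ∀ᶠ n : ℕ in atTop,
            δ * n < (((Finset.range n).filter fun t => X t ω ∈ B m).card : ℝ)}
          ⊆ ⋃ N : ℕ, ⋂ n ≥ N,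
            {ω | δ * n < (((Finset.range n).filter fun t => X t ω ∈ B m).card : ℝ)} := by
        intro ω hω
        obtain ⟨N, hN⟩ := eventually_atTop.1 (hω m)
        exact Set.mem_iUnion.2 ⟨N, Set.mem_iInter₂.2 hN⟩
      refine (measure_mono hsub).trans ?_
      rw [Monotone.measure_iUnion fun N N' hNN => Set.biInter_subset_biInter_left
        fun n hn => le_trans hNN hn]
      refine iSup_le fun N => ?_
      exact (measure_mono (Set.biInter_subset_of_mem (le_max_left N 1))).trans
        (hmarkov δ hδ m _ (le_max_right N 1))
  have hall : ∀ᵐ ω ∂Pr, ∀ k : ℕ, ∃ m, ∃ᶠ n : ℕ in atTop,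
      (((Finset.range n).filter fun t => X t ω ∈ B m).card : ℝ) ≤ 1 / ((k : ℝ) + 1) * n :=
    ae_all_iff.2 fun k => hδ _ Nat.one_div_pos_of_nat
  filter_upwards [hall] with ω hω δ hδ
  obtain ⟨k, hk⟩ := exists_nat_one_div_lt hδ
  obtain ⟨m, hm⟩ := hω k
  exact ⟨m, hm.mono fun n hn => hn.trans
    (mul_le_mul_of_nonneg_right hk.le (Nat.cast_nonneg n))⟩

/-! ### Generic invertibility of the channel -/

section

variable {K : ℕ} {A U : Finset (Fin K)}

/-- The square matrix of the coefficients from the transmitters in `U` to the receivers in `A`,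
its columns being indexed by `A` through a bijection. -/
def crossMatrix (e : {i // i ∈ A} ≃ {j // j ∈ U}) (x : Fin K × Fin K → ℂ) :
    Matrix {i // i ∈ A} {i // i ∈ A} ℂ :=
  Matrix.of fun k a => x (k, e a)

/-- The matrix that recovers the outputs outside `A` from those in `A`, as far as they come from
the transmitters in `U`; it is meaningful if `crossMatrix e x` is invertible. -/
noncomputable def recovery (e : {i // i ∈ A} ≃ {j // j ∈ U}) (x : Fin K × Fin K → ℂ)
    (i : {i // i ∉ A}) (k : {i // i ∈ A}) : ℂ :=
  ∑ a, x (i, e a) * (crossMatrix e x)⁻¹ a k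

theorem resolves_of_det_ne_zero (e : {i // i ∈ A} ≃ {j // j ∈ U}) {x : Fin K × Fin K → ℂ}
    (hdet : (crossMatrix e x).det ≠ 0) :
    Resolves A U (∑ i, ∑ k, ‖recovery e x i k‖ ^ 2) (Matrix.of fun i j => x (i, j)) := by
  refine ⟨recovery e x, fun i j hj => ?_, le_rfl⟩
  obtain ⟨b, hb⟩ := e.surjective ⟨j, hj⟩
  have hj' : j = e b := by rw [hb]
  have hinv := Matrix.nonsing_inv_mul (crossMatrix e x) (isUnit_iff_ne_zero.2 hdet)
  subst hj'
  have : ∀ a, ∑ k, (crossMatrix e x)⁻¹ a k * x (k, e b) = if a = b then 1 else 0 := fun a => by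
    have := congrFun (congrFun hinv a) b
    rwa [Matrix.mul_apply, Matrix.one_apply] at this
  simp_rw [recovery, Finset.sum_mul, Matrix.of_apply]
  rw [Finset.sum_comm]
  simp_rw [mul_assoc, ← Finset.mul_sum, this]
  simp

theorem Resolves.mono {L L' : ℝ} (hL : L ≤ L') {M : Matrix (Fin K) (Fin K) ℂ}
    (h : Resolves A U L M) : Resolves A U L' M := by
  obtain ⟨G, hG, hGL⟩ := h
  exact ⟨G, hG, hGL.trans hL⟩

theorem measurable_det_crossMatrix (e : {i // i ∈ A} ≃ {j // j ∈ U}) :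
    Measurable fun x => (crossMatrix e x).det := by
  refine Continuous.measurable (Continuous.matrix_det ?_)
  exact continuous_matrix fun i j => continuous_apply _

theorem measurable_recovery (e : {i // i ∈ A} ≃ {j // j ∈ U}) (i : {i // i ∉ A})
    (k : {i // i ∈ A}) : Measurable fun x => recovery e x i k := by
  have hadj : ∀ a b, Measurable fun x => (crossMatrix e x).adjugate a b := fun a b => by
    refine Continuous.measurable (Continuous.matrix_elem (Continuous.matrix_adjugate ?_) a b)
    exact continuous_matrix fun i j => continuous_apply _
  have hdet := measurable_det_crossMatrix e
  simp only [recovery, Matrix.inv_def, Ring.inverse_eq_inv', Matrix.smul_apply, smul_eq_mul]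
  fun_prop

/-- The entries of `crossMatrix e x` are distinct coordinates of `x`, so its determinant is a
nonzero polynomial in `x`. -/
theorem pi_det_crossMatrix_eq_zero (μ : Measure ℂ) [SigmaFinite μ] [NullSingletonClass μ]
    (e : {i // i ∈ A} ≃ {j // j ∈ U}) :
    Measure.pi (fun _ : Fin K × Fin K => μ) {x | (crossMatrix e x).det = 0} = 0 := by
  let f : {i // i ∈ A} × {i // i ∈ A} → Fin K × Fin K := fun p => (p.1, e p.2)
  have hf : Function.Injective f := fun p q hpq => by
    simp only [f, Prod.mk.injEq] at hpq
    exact Prod.ext (Subtype.ext hpq.1) (e.injective (Subtype.ext hpq.2))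
  set p := MvPolynomial.rename f
    (Matrix.mvPolynomialX {i // i ∈ A} {i // i ∈ A} ℂ).det with hp
  have hp0 : p ≠ 0 := fun h =>
    Matrix.det_mvPolynomialX_ne_zero {i // i ∈ A} ℂ
      (MvPolynomial.rename_injective f hf (by rw [← hp, h, map_zero]))
  have heval : ∀ x, MvPolynomial.eval x p = (crossMatrix e x).det := fun x => by
    rw [hp, MvPolynomial.eval_rename, RingHom.map_det]
    congr 1
    exact Matrix.mvPolynomialX_mapMatrix_eval (crossMatrix e x)
  have := pi_zeros_eq_zero μ hp0
  simpa only [heval] using this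

open Classical in
/-- Almost surely, for a suitable bound on the recovery matrix, the fraction of the time at which
the channel fails to resolve is arbitrarily small along arbitrarily large block lengths. -/
theorem IsFullyConnected.ae_frequently_resolves {Ω : Type*} [MeasurableSpace Ω] {Pr : Measure Ω}
    [IsProbabilityMeasure Pr] {μ : Measure ℂ} [IsProbabilityMeasure μ] [NullSingletonClass μ]
    {H : ℕ → Fin K → Fin K → Ω → ℂ} (hH : IsFullyConnected μ Pr H)
    (e : {i // i ∈ A} ≃ {j // j ∈ U}) :
    ∀ᵐ ω ∂Pr, ∀ δ : ℝ, 0 < δ → ∃ L : ℝ, 0 ≤ L ∧ ∃ᶠ n : ℕ in atTop,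
      (((Finset.range n).filter fun t =>
        ¬ Resolves A U L (Matrix.of fun i j => H t i j ω)).card : ℝ) ≤ δ * n := by
  set Λ := Measure.pi fun _ : Fin K × Fin K => μ
  set B : ℕ → Set (Fin K × Fin K → ℂ) := fun m =>
    {x | (crossMatrix e x).det = 0 ∨ (m : ℝ) < ∑ i, ∑ k, ‖recovery e x i k‖ ^ 2} with hBdef
  have hX : ∀ t, Measurable fun ω => fun p : Fin K × Fin K => H t p.1 p.2 ω := fun t =>
    measurable_pi_lambda _ fun p => hH.measurable t p.1 p.2
  have hlaw : ∀ t, Pr.map (fun ω => fun p : Fin K × Fin K => H t p.1 p.2 ω) = Λ := fun t => by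
    rw [(iIndepFun_iff_map_fun_eq_pi_map fun p : Fin K × Fin K =>
      (hH.measurable t p.1 p.2).aemeasurable).1 (hH.indep t)]
    simp_rw [hH.law, Λ]
  have hdet : MeasurableSet {x : Fin K × Fin K → ℂ | (crossMatrix e x).det = 0} :=
    measurable_det_crossMatrix e (measurableSet_singleton 0)
  have hsum : Measurable fun x => ∑ i, ∑ k, ‖recovery e x i k‖ ^ 2 :=
    Finset.measurable_fun_sum _ fun i _ => Finset.measurable_fun_sum _ fun k _ =>
      (measurable_recovery e i k).norm.pow_const 2
  have hB : ∀ m, MeasurableSet (B m) := fun m =>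
    hdet.union (measurableSet_lt measurable_const hsum)
  have hanti : Antitone B := fun m m' hmm x hx =>
    hx.imp id fun h => lt_of_le_of_lt (by exact_mod_cast hmm) h
  have hinter : ⋂ m, B m ⊆ {x | (crossMatrix e x).det = 0} := fun x hx => by
    obtain ⟨m, hm⟩ := exists_nat_ge (∑ i, ∑ k, ‖recovery e x i k‖ ^ 2)
    exact (Set.mem_iInter.1 hx m).resolve_right (not_lt.2 hm)
  have hlim : Tendsto (fun m => Λ (B m)) atTop (𝓝 0) := by
    have := tendsto_measure_iInter_atTop (μ := Λ) (fun m => (hB m).nullMeasurableSet) hanti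
      ⟨0, measure_ne_top _ _⟩
    rwa [measure_mono_null hinter (pi_det_crossMatrix_eq_zero μ e)] at this
  filter_upwards [ae_frequently_card_filter_le Pr hX hlaw hB hlim] with ω hω δ hδ
  obtain ⟨m, hm⟩ := hω δ hδ
  refine ⟨m, m.cast_nonneg, hm.mono fun n hn => le_trans ?_ hn⟩
  refine Nat.cast_le.2 (Finset.card_le_card (Finset.monotone_filter_right _ fun t _ ht => ?_))
  by_contra hbad
  have hbad : ¬ _ ∧ ¬ _ := not_or.1 hbad
  exact ht ((resolves_of_det_ne_zero e hbad.1).mono (not_lt.1 hbad.2))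

end

/-! ### Sparse subfamilies of the transmit sets -/

section

section

variable {ι V : Type*} [DecidableEq ι] [DecidableEq V]

/-- Subfamilies of `E` of every size `t` cover as few vertices as if they were connected: at most
`(M - 1) t + 1`, where `M` is the size of the edges `N i`. -/
def HasSparseSubfamilies (N : ι → Finset V) (M : ℕ) (E : Finset ι) : Prop :=
  ∀ t ≤ E.card, ∃ B ⊆ E, B.card = t ∧ (B.biUnion N).card ≤ (M - 1) * t + 1

/-- A family of at least as many edges of size at most `M` as vertices has subfamilies of every
size `t` that cover at most `(M - 1) t + 1` vertices. A maximal subfamily `B` with this property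
either is the whole family, or shares no vertex with the rest and covers more than `|B|` vertices.
In the latter case the rest covers fewer vertices than it has edges, and induction applies to it;
families larger than the rest are obtained by adding a part of `B` to it. -/
theorem hasSparseSubfamilies {N : ι → Finset V} {M : ℕ} (hM : 2 ≤ M)
    (hN : ∀ i, (N i).card ≤ M) (E : Finset ι) (hE : (E.biUnion N).card ≤ E.card) :
    HasSparseSubfamilies N M E := by
  classical
  induction E using Finset.strongInduction with
  | H E ih =>
  obtain ⟨q, rfl⟩ : ∃ q, M = q + 2 := ⟨M - 2, by omega⟩
  simp only [HasSparseSubfamilies, show q + 2 - 1 = q + 1 by omega] at ih ⊢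
  obtain ⟨B, hB, hmax⟩ := Finset.exists_max_image
    (E.powerset.filter fun B => ∀ t ≤ B.card, ∃ B' ⊆ B, B'.card = t
      ∧ (B'.biUnion N).card ≤ (q + 1) * t + 1) Finset.card
    ⟨∅, by simp⟩
  obtain ⟨hBE, hQ⟩ := Finset.mem_filter.1 hB
  rw [Finset.mem_powerset] at hBE
  have hBcard : (B.biUnion N).card ≤ (q + 1) * B.card + 1 := by
    obtain ⟨B', hB', hc, h⟩ := hQ _ le_rfl
    rwa [Finset.eq_of_subset_of_card_le hB' hc.ge] at h
  rcases eq_or_ne B E with rfl | hne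
  · exact hQ
  have hstuck : ∀ i ∈ E \ B, (q + 1) * (B.card + 1) + 1 < ((insert i B).biUnion N).card := by
    intro i hi
    obtain ⟨hiE, hiB⟩ := Finset.mem_sdiff.1 hi
    by_contra hcon
    have := hmax (insert i B) (Finset.mem_filter.2 ⟨Finset.mem_powerset.2
      (Finset.insert_subset hiE hBE), fun t ht => ?_⟩)
    · rw [Finset.card_insert_of_notMem hiB] at this
      omega
    · rw [Finset.card_insert_of_notMem hiB] at ht
      rcases Nat.lt_or_ge B.card t with h | h
      · obtain rfl : t = B.card + 1 := by omega
        exact ⟨_, subset_rfl, Finset.card_insert_of_notMem hiB, not_lt.1 hcon⟩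
      · obtain ⟨B', hB', hc, hle⟩ := hQ t h
        exact ⟨B', hB'.trans (Finset.subset_insert i B), hc, hle⟩
  have hclosed : ∀ i ∈ E \ B, (B.biUnion N).card = (q + 1) * B.card + 1
      ∧ Disjoint (N i) (B.biUnion N) := by
    intro i hi
    have h1 := hstuck i hi
    rw [Finset.biUnion_insert] at h1
    have h2 := Finset.card_union_add_card_inter (N i) (B.biUnion N)
    have h3 := hN i
    have h4 : (q + 1) * (B.card + 1) = (q + 1) * B.card + q + 1 := by ring
    exact ⟨by omega, Finset.disjoint_iff_inter_eq_empty.2 (Finset.card_eq_zero.1 (by omega))⟩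
  obtain ⟨i₀, hi₀⟩ : (E \ B).Nonempty :=
    Finset.sdiff_nonempty.2 fun h => hne (hBE.antisymm h)
  have hBfull := (hclosed i₀ hi₀).1
  have hBpos : B.Nonempty := by
    rw [Finset.nonempty_iff_ne_empty]
    rintro rfl
    simp at hBfull
  have hdisj : Disjoint ((E \ B).biUnion N) (B.biUnion N) :=
    (Finset.disjoint_biUnion_left _ _ _).2 fun i hi => (hclosed i hi).2
  have hunion : ((E \ B).biUnion N).card + (B.biUnion N).card ≤ E.card := by
    rw [← Finset.card_union_of_disjoint hdisj, ← Finset.union_biUnion,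
      Finset.sdiff_union_of_subset hBE]
    exact hE
  have hcardE := Finset.card_sdiff_add_card_eq_card hBE
  have hq : (q + 1) * B.card = q * B.card + B.card := by ring
  have hrest := ih (E \ B) (Finset.sdiff_ssubset hBE hBpos) (by omega)
  intro t ht
  rcases Nat.le_total t (E \ B).card with h | h
  · obtain ⟨B', hB', hc, hle⟩ := hrest t h
    exact ⟨B', hB'.trans Finset.sdiff_subset, hc, hle⟩
  · obtain ⟨B', hB', hc, hle⟩ := hQ (t - (E \ B).card) (by omega)
    refine ⟨(E \ B) ∪ B', Finset.union_subset Finset.sdiff_subset (hB'.trans hBE), ?_, ?_⟩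
    · rw [Finset.card_union_of_disjoint (Finset.disjoint_of_subset_right hB'
        Finset.sdiff_disjoint), hc]
      omega
    · rw [Finset.union_biUnion]
      refine (Finset.card_union_le _ _).trans ?_
      have h5 : (q + 1) * t = (q + 1) * (t - (E \ B).card) + (q + 1) * (E \ B).card := by
        rw [← mul_add, Nat.sub_add_cancel h]
      have h6 : (q + 1) * (E \ B).card = q * (E \ B).card + (E \ B).card := by ring
      omega

/-- There are a set `A` of receivers and a set `U` of transmitters of the same size, about
`K (M - 1) / M`, such that the messages of the receivers outside `A` are known only to transmitters
in `U`. -/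
theorem exists_receivers_transmitters {K M : ℕ} (hM : 2 ≤ M) (hK : 0 < K)
    {T : Fin K → Finset (Fin K)} (hT : ∀ i, (T i).card ≤ M) :
    ∃ A U : Finset (Fin K), A.card = U.card ∧ A.card = K - (K - 1) / M
      ∧ ∀ i ∉ A, T i ⊆ U := by
  have hdiv : M * ((K - 1) / M) ≤ K - 1 := Nat.mul_div_le _ _
  obtain ⟨q, rfl⟩ : ∃ q, M = q + 2 := ⟨M - 2, by omega⟩
  set b := (K - 1) / (q + 2)
  have hb : (q + 2) * b = (q + 1) * b + b := by ring
  obtain ⟨B, -, hBc, hB⟩ := hasSparseSubfamilies hM hT Finset.univ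
    ((Finset.card_le_univ _).trans_eq Finset.card_univ.symm) b
    (by rw [Finset.card_univ, Fintype.card_fin]; omega)
  rw [show q + 2 - 1 = q + 1 by omega] at hB
  obtain ⟨U, hBU, hU⟩ := Finset.exists_superset_card_eq (s := B.biUnion T) (n := K - b)
    (by omega) (by rw [Fintype.card_fin]; omega)
  have hA : Bᶜ.card = K - b := by rw [Finset.card_compl, Fintype.card_fin, hBc]
  refine ⟨Bᶜ, U, by rw [hA, hU], hA, fun i hi => ?_⟩
  exact (Finset.subset_biUnion_of_mem T (by simpa using hi)).trans hBU

end

variable {Ω : Type*} [MeasurableSpace Ω] {Pr : Measure Ω} [IsProbabilityMeasure Pr]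
  {μ : Measure ℂ} [IsProbabilityMeasure μ] [NullSingletonClass μ]

theorem IsFullyConnected.dof_le {K : ℕ} {H : ℕ → Fin K → Fin K → Ω → ℂ}
    (hH : IsFullyConnected μ Pr H) {T : Fin K → Finset (Fin K)} {A U : Finset (Fin K)}
    (hAU : A.card = U.card) (hU : ∀ i ∉ A, T i ⊆ U) :
    dof Pr H T ≤ ((A.card : ℝ) : EReal) := by
  have hsub : dofRegion Pr H T ⊆ {d | ∑ i, d i ≤ A.card} := by
    refine closure_minimal (fun d hd => ?_) (isClosed_le (by fun_prop) continuous_const)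
    have hd : ∀ᵐ ω ∂Pr, AchievesDoF T (fun t => Matrix.of fun i j => H t i j ω) d := hd
    obtain ⟨ω, hω, hbdd, hres⟩ := (hd.and (hH.bdd.and
      (hH.ae_frequently_resolves (Finset.equivOfCardEq hAU)))).exists
    exact sum_dof_le hU hbdd hres hω
  exact iSup₂_le fun d hd => EReal.coe_le_coe_iff.2 (hsub hd)

theorem IsFullyConnected.eta_le {K M : ℕ} {H : ℕ → Fin K → Fin K → Ω → ℂ}
    (hH : IsFullyConnected μ Pr H) (hM : 2 ≤ M) (hK : 0 < K) :
    eta Pr H M ≤ (((K - (K - 1) / M : ℕ) : ℝ) : EReal) := by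
  refine iSup₂_le fun T hT => ?_
  obtain ⟨A, U, hAU, hA, hU⟩ := exists_receivers_transmitters hM hK hT
  rw [← hA]
  exact hH.dof_le hAU hU

theorem sub_div_div_le {K M : ℕ} (hM : 2 ≤ M) (hK : 0 < K) :
    ((K - (K - 1) / M : ℕ) : ℝ) / K ≤ ((M : ℝ) - 1) / M + 2 / K := by
  have hM' : (2 : ℝ) ≤ M := by exact_mod_cast hM
  have hK' : (0 : ℝ) < K := by exact_mod_cast hK
  have h1 : K ≤ M * ((K - 1) / M) + M := by
    have := Nat.lt_mul_div_succ (K - 1) (show 0 < M by omega)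
    rw [mul_add, mul_one] at this
    omega
  have h2 : (K : ℝ) ≤ M * ((K - 1) / M : ℕ) + M := by exact_mod_cast h1
  have h3 : (K - 1) / M ≤ K := (Nat.div_le_self _ _).trans (Nat.sub_le _ _)
  rw [Nat.cast_sub h3, div_add_div _ _ (by positivity) (by positivity),
    div_le_div_iff₀ (by positivity) (by positivity)]
  nlinarith

end

end CoMP

theorem mainTheorem3 {Ω : Type*} [MeasurableSpace Ω] (Pr : MeasureTheory.Measure Ω)
    [MeasureTheory.IsProbabilityMeasure Pr]
    (μ : MeasureTheory.Measure ℂ) [MeasureTheory.IsProbabilityMeasure μ]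
    (hμ : ∀ z : ℂ, μ {z} = 0)
    (H : (K : ℕ) → ℕ → Fin K → Fin K → Ω → ℂ)
    (hH : ∀ K, CoMP.IsFullyConnected μ Pr (H K))
    (M : ℕ) (hM : 2 ≤ M) :
    CoMP.tau Pr H M ≤ ((((M : ℝ) - 1) / (M : ℝ) : ℝ) : EReal) := by
  have : NullSingletonClass μ := ⟨hμ⟩
  have hlim : Tendsto (fun K : ℕ => ((M : ℝ) - 1) / M + 2 / K) atTop
      (𝓝 (((M : ℝ) - 1) / M + 0)) :=
    (tendsto_const_div_atTop_nhds_zero_nat 2).const_add _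
  rw [add_zero] at hlim
  rw [← ((continuous_coe_real_ereal.tendsto _).comp hlim).limsup_eq]
  refine limsup_le_limsup ?_
  filter_upwards [eventually_gt_atTop 0] with K hK
  refine (EReal.div_le_div_right_of_nonneg (by positivity) ((hH K).eta_le hM hK)).trans ?_
  rw [← EReal.coe_natCast, ← EReal.coe_div]
  exact EReal.coe_le_coe_iff.2 (CoMP.sub_div_div_le hM hK)
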